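/- Let $k$ be an algebraically closed field of characteristic zero and let $\mathcal D$ be an algebraic $k$-linear triangulated category (i.e. equivalent, as a $k$-linear triangulated category, to the stable category of a $k$-linear Frobenius exact category) with translation functor $[1]$, of finite type: $\sum_{p\in\mathbb Z}\dim_k\mathrm{Hom}_{\mathcal D}(X,Y[p])<\infty$ for all $X,Y\in\mathcal D$. An object $E$ is exceptional if $\mathrm{Hom}(E,E)=k\cdot\mathrm{id}_E$ is one-dimensional and $\mathrm{Hom}(E,E[p])=0$ for $p\neq 0$. An exceptional collection is a finite sequence $(E_1,\dots,E_n)$ of exceptional objects with $\mathrm{Hom}(E_i,E_j[p])=0$ for all $i>j$ and all $p$; it is strongly exceptional if moreover $\mathrm{Hom}(E_i,E_j[p])=0$ for all $i,j$ and all $p\ne0$, and full if the smallest strictly full triangulated subcategory containing all $E_i$ is $\mathcal D$. For an exceptional pair $(X,Y)$, the right mutation $R_YX$ is the cone of the coevaluation $X\to\mathrm{Hom}^\bullet(X,Y)^*\otimes Y=\bigoplus_p \mathrm{Hom}(X,Y[p])^*\otimes_k Y[p]$, and the left mutation $L_XY$ is the object such that $(L_XY)[1]$ is the cone of the evaluation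 $\mathrm{Hom}^\bullet(X,Y)\otimes X=\bigoplus_p\mathrm{Hom}(X,Y[p])\otimes_k X[-p]\to Y$. The group $G_\mu=B_\mu\ltimes\mathbb Z^\mu$, where Artin's braid group $B_\mu$ (generators $b_1,\dots,b_{\mu-1}$) acts on $\mathbb Z^\mu$ (standard basis $e_1,\dots,e_\mu$) by permuting coordinates through $b_i\mapsto(i,i+1)$, acts on the set of isomorphism classes of full exceptional collections of length $\mu$ by $$b_i(E_1,\dots,E_\mu)=(E_1,\dots,E_{i-1},E_{i+1},R_{E_{i+1}}E_i,E_{i+2},\dots,E_\mu),$$ $$b_i^{-1}(E_1,\dots,E_\mu)=(E_1,\dots,E_{i-1},L_{E_i}E_{i+1},E_i,E_{i+2},\dots,E_\mu),$$ $$e_i(E_1,\dots,E_\mu)=(E_1,\dots,E_{i-1},E_i[1],E_{i+1},\dots,E_\mu).$$ Assume: (1) there is a full strongly exceptional collection $\mathcal E=(E_1,\dots,E_\mu)$ in $\mathcal D$; (2) the action of $G_\mu$ on the set of isomorphism classes of full exceptional collections is transitive; (3) every exceptional object of $\mathcal D$ is a member of some full exceptional collection. Let $K_0(\mathcal D)$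 be the Grothendieck group. Then: (a) There is a (necessarily unique) bilinear form $\chi_{\mathcal D}$ on $K_0(\mathcal D)$ (the Euler form) with $\chi_{\mathcal D}([X],[Y])=\sum_{p}(-1)^p\dim_k\mathrm{Hom}(X,Y[p])$ for all $X,Y\in\mathcal D$. Put $I_{\mathcal D}(x,y)=\chi_{\mathcal D}(x,y)+\chi_{\mathcal D}(y,x)$. (b) $\mathcal D$ has a Serre functor $S_{\mathcal D}$ (a $k$-linear autoequivalence with natural isomorphisms $\mathrm{Hom}(X,Y)\cong\mathrm{Hom}(Y,S_{\mathcal D}X)^*$), and $S_{\mathcal D}[-1]$ induces an automorphism $c_{\mathcal D}$ of $K_0(\mathcal D)$, $c_{\mathcal D}[X]=[(S_{\mathcal D}X)[-1]]$, which is the same for every choice of $S_{\mathcal D}$. (c) Let $r_\alpha(\lambda)=\lambda-I_{\mathcal D}(\lambda,\alpha)\alpha$, let $B=\{[E_1],\dots,[E_\mu]\}$, let $W(B)\subset\mathrm{Aut}(K_0(\mathcal D),I_{\mathcal D})$ be the group generated by the $r_{[E_i]}$, and put $\Delta_{re}(\mathcal D)=W(B)B$. The quadruple $(K_0(\mathcal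 D),I_{\mathcal D},\Delta_{re}(\mathcal D),c_{\mathcal D})$ is a simply-laced generalized root system. That is: $K_0(\mathcal D)$ is a free $\mathbb Z$-module of finite rank; $I_{\mathcal D}$ is symmetric; $\Delta_{re}(\mathcal D)$ spans $K_0(\mathcal D)$ over $\mathbb Z$; $I_{\mathcal D}(\alpha,\alpha)=2$ and $r_\alpha(\Delta_{re}(\mathcal D))=\Delta_{re}(\mathcal D)$ for all $\alpha\in\Delta_{re}(\mathcal D)$; with $W=\langle r_\alpha\mid\alpha\in\Delta_{re}(\mathcal D)\rangle$ there is a root basis, i.e. a $\mathbb Z$-basis $\alpha_1,\dots,\alpha_n$ of $K_0(\mathcal D)$ contained in $\Delta_{re}(\mathcal D)$ with $W=\langle r_{\alpha_1},\dots,r_{\alpha_n}\rangle$ and $\Delta_{re}(\mathcal D)=W\{\alpha_1,\dots,\alpha_n\}$; and $c_{\mathcal D}\in W$ equals $r_{\alpha_1}\cdots r_{\alpha_n}$ for some (ordered) root basis. (d) This root system does not depend on the chosen collection: for every full exceptional collection $(F_1,\dots,F_n)$ in $\mathcal D$, with $B'=\{[F_1],\dots,[F_n]\}$, one has $W(B')B'=W(B)B$.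 -/

import Mathlib

open CategoryTheory CategoryTheory.Limits CategoryTheory.Pretriangulated

universe w v u v' u'

noncomputable section

/-! ## Simply-laced generalized root systems -/

section RootSystems

variable {K : Type*} [AddCommGroup K]

/-- The map `r_α(x) = x - I(x, α) α`. When `I` is symmetric and `I(α, α) = 2` it is an involutive
automorphism of `K` that preserves `I`. -/
def rootReflection (I : LinearMap.BilinForm ℤ K) (α : K) : K →ₗ[ℤ] K :=
  Module.preReflection α (I.flip α)

/-- `Aut(K, I)`, the group of automorphisms of `K` that preserve the bilinear form `I`. -/
def isometryGroup (I : LinearMap.BilinForm ℤ K) : Subgroup (K ≃ₗ[ℤ] K) where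
  carrier := {g | ∀ x y, I (g x) (g y) = I x y}
  mul_mem' := fun {a b} ha hb x y => (ha (b x) (b y)).trans (hb x y)
  one_mem' := fun _ _ => rfl
  inv_mem' := fun {a} ha x y => by
    have h := ha (a⁻¹ x) (a⁻¹ y)
    rw [← LinearEquiv.mul_apply, ← LinearEquiv.mul_apply, mul_inv_cancel] at h
    exact h.symm

/-- The subgroup of `Aut(K, I)` generated by the reflections `r_α` with `α ∈ S` (regarded as a
subgroup of `Aut(K)`). -/
def reflectionGroup (I : LinearMap.BilinForm ℤ K) (S : Set K) : Subgroup (K ≃ₗ[ℤ] K) :=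
  Subgroup.closure {g | g ∈ isometryGroup I ∧ ∃ α ∈ S, (g : K →ₗ[ℤ] K) = rootReflection I α}

/-- The set `W(B) B`, where `W(B)` is the group generated by the reflections in elements
of `B`. -/
def reflectionOrbit (I : LinearMap.BilinForm ℤ K) (B : Set K) : Set K :=
  {x | ∃ g ∈ reflectionGroup I B, ∃ β ∈ B, g β = x}

/-- `α = (α_1, …, α_n)` is an (ordered) root basis of `(K, I, Δ)`: it lies in `Δ`, it is a
`ℤ`-basis of `K`, its reflections generate `W(R) = ⟨r_α | α ∈ Δ⟩`, and `Δ = W(R) {α_1, …, α_n}`. -/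
structure IsRootBasis (I : LinearMap.BilinForm ℤ K) (Δ : Set K) {n : ℕ} (α : Fin n → K) :
    Prop where
  mem : ∀ i, α i ∈ Δ
  linearIndependent : LinearIndependent ℤ α
  span_eq_top : Submodule.span ℤ (Set.range α) = ⊤
  reflectionGroup_eq : reflectionGroup I Δ = reflectionGroup I (Set.range α)
  roots_eq : Δ = {x | ∃ g ∈ reflectionGroup I Δ, ∃ i, g (α i) = x}

/-- The quadruple `(K, I, Δ, c)` is a simply-laced generalized root system. -/
structure IsSimplyLacedGRS (I : LinearMap.BilinForm ℤ K) (Δ : Set K) (c : K ≃ₗ[ℤ] K) :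
    Prop where
  /-- the root lattice is free of finite rank -/
  free : Module.Free ℤ K
  finite : Module.Finite ℤ K
  symm : ∀ x y, I x y = I y x
  /-- the real roots span the root lattice -/
  span_roots : Submodule.span ℤ Δ = ⊤
  norm_root : ∀ α ∈ Δ, I α α = 2
  reflection_image : ∀ α ∈ Δ, rootReflection I α '' Δ = Δ
  exists_rootBasis : ∃ (n : ℕ) (α : Fin n → K), IsRootBasis I Δ α
  /-- the Coxeter transformation is an element of the Weyl group -/
  coxeter_mem : c ∈ reflectionGroup I Δ
  /-- the Coxeter transformation is `r_{α_1} ⋯ r_{α_n}` for some root basis -/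
  coxeter_eq : ∃ (n : ℕ) (α : Fin n → K), IsRootBasis I Δ α ∧
    (c : K →ₗ[ℤ] K) =
      (List.ofFn fun i => (rootReflection I (α i) : Module.End ℤ K)).prod

end RootSystems

/-! ## Exact categories, Frobenius categories and stable categories -/

section Frobenius

variable (A : Type u') [Category.{v'} A] [Preadditive A]

/-- A (Quillen) exact structure on an additive category: a class of kernel-cokernel pairs
`X₁ ⟶ X₂ ⟶ X₃` (the conflations), closed under isomorphisms, such that the inflations
(first maps of conflations) and deflations (second maps) contain the identities, are closed under
composition, and such that inflations are stable under pushouts, which exist, and deflations are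
stable under pullbacks, which exist. -/
structure QuillenExactStructure where
  conflation : ShortComplex A → Prop
  of_iso : ∀ {S T : ShortComplex A}, (S ≅ T) → conflation S → conflation T
  isKernel : ∀ {S : ShortComplex A}, conflation S →
    Nonempty (IsLimit (KernelFork.ofι S.f S.zero))
  isCokernel : ∀ {S : ShortComplex A}, conflation S →
    Nonempty (IsColimit (CokernelCofork.ofπ S.g S.zero))
  id_inflation : ∀ X : A, ∃ S : ShortComplex A, conflation S ∧
    Nonempty (Arrow.mk S.f ≅ Arrow.mk (𝟙 X))
  id_deflation : ∀ X : A, ∃ S : ShortComplex A, conflation S ∧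
    Nonempty (Arrow.mk S.g ≅ Arrow.mk (𝟙 X))
  comp_inflation : ∀ {X Y Z : A} (i : X ⟶ Y) (j : Y ⟶ Z),
    (∃ (Q : A) (p : Y ⟶ Q) (h : i ≫ p = 0), conflation (ShortComplex.mk i p h)) →
    (∃ (Q : A) (p : Z ⟶ Q) (h : j ≫ p = 0), conflation (ShortComplex.mk j p h)) →
    ∃ (Q : A) (p : Z ⟶ Q) (h : (i ≫ j) ≫ p = 0), conflation (ShortComplex.mk (i ≫ j) p h)
  comp_deflation : ∀ {X Y Z : A} (p : X ⟶ Y) (q : Y ⟶ Z),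
    (∃ (N : A) (i : N ⟶ X) (h : i ≫ p = 0), conflation (ShortComplex.mk i p h)) →
    (∃ (N : A) (i : N ⟶ Y) (h : i ≫ q = 0), conflation (ShortComplex.mk i q h)) →
    ∃ (N : A) (i : N ⟶ X) (h : i ≫ p ≫ q = 0), conflation (ShortComplex.mk i (p ≫ q) h)
  pushout_inflation : ∀ {X Y X' : A} (i : X ⟶ Y) (f : X ⟶ X'),
    (∃ (Q : A) (p : Y ⟶ Q) (h : i ≫ p = 0), conflation (ShortComplex.mk i p h)) →
    ∃ (Y' : A) (g : Y ⟶ Y') (i' : X' ⟶ Y'), IsPushout i f g i' ∧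
      ∃ (Q : A) (p : Y' ⟶ Q) (h : i' ≫ p = 0), conflation (ShortComplex.mk i' p h)
  pullback_deflation : ∀ {Y Z Z' : A} (p : Y ⟶ Z) (f : Z' ⟶ Z),
    (∃ (N : A) (i : N ⟶ Y) (h : i ≫ p = 0), conflation (ShortComplex.mk i p h)) →
    ∃ (Y' : A) (g : Y' ⟶ Y) (p' : Y' ⟶ Z'), IsPullback g p' p f ∧
      ∃ (N : A) (i : N ⟶ Y') (h : i ≫ p' = 0), conflation (ShortComplex.mk i p' h)

namespace QuillenExactStructure

variable {A} (𝓔 : QuillenExactStructure A)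

/-- Projectivity relative to the conflations. -/
def IsProj (P : A) : Prop :=
  ∀ S : ShortComplex A, 𝓔.conflation S → ∀ f : P ⟶ S.X₃, ∃ g : P ⟶ S.X₂, g ≫ S.g = f

/-- Injectivity relative to the conflations. -/
def IsInj (J : A) : Prop :=
  ∀ S : ShortComplex A, 𝓔.conflation S → ∀ f : S.X₁ ⟶ J, ∃ g : S.X₂ ⟶ J, S.f ≫ g = f

/-- A Frobenius category: an exact category with enough projectives and enough injectives,
in which projectives and injectives coincide. -/
structure IsFrobenius : Prop where
  enough_proj : ∀ X : A, ∃ S : ShortComplex A, 𝓔.conflation S ∧ 𝓔.IsProj S.X₂ ∧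
    Nonempty (S.X₃ ≅ X)
  enough_inj : ∀ X : A, ∃ S : ShortComplex A, 𝓔.conflation S ∧ 𝓔.IsInj S.X₂ ∧
    Nonempty (S.X₁ ≅ X)
  proj_iff_inj : ∀ X : A, 𝓔.IsProj X ↔ 𝓔.IsInj X

/-- Two morphisms are identified in the stable category when their difference factors through
an injective object. -/
def stableRel : HomRel A := fun X Y f g =>
  ∃ (J : A) (_ : 𝓔.IsInj J) (a : X ⟶ J) (b : J ⟶ Y), f - g = a ≫ b

/-- The stable category: same objects, morphisms modulo those factoring through an injective. -/
abbrev StableCategory := CategoryTheory.Quotient 𝓔.stableRel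

/-- The projection from an exact category to its stable category. -/
abbrev toStable : A ⥤ 𝓔.StableCategory := CategoryTheory.Quotient.functor 𝓔.stableRel

end QuillenExactStructure

/-- `D` is an algebraic `k`-linear triangulated category: it is equivalent, as a `k`-linear
triangulated category, to the stable category of a `k`-linear Frobenius category.

The equivalence is `Φ`. In the stable category a conflation `X₁ ⟶ X₂ ⟶ X₃` has a connecting
morphism `X₃ ⟶ ΣX₁`, natural in the conflation, and the distinguished triangles are, up to
isomorphism, the resulting `X₁ ⟶ X₂ ⟶ X₃ ⟶ ΣX₁`. So an isomorphism `Φ Σ ≅ [1] Φ` which makes `Φ` a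
triangle functor is the same as a natural family of connecting morphisms
`δ : Φ X₃ ⟶ (Φ X₁)[1]` which completes the image of every conflation to a distinguished triangle;
on the conflations `X ⟶ J ⟶ ΣX` with `J` injective the family `δ` is the isomorphism
`Φ ΣX ≅ (Φ X)[1]`. -/
def IsAlgebraicTriangulated (k : Type w) [Field k] (D : Type u) [Category.{v} D] [Preadditive D]
    [HasZeroObject D] [HasShift D ℤ] [∀ n : ℤ, (shiftFunctor D n).Additive] [Pretriangulated D]
    [Linear k D] : Prop :=
  ∃ (A : Type u') (_ : Category.{v'} A) (_ : Preadditive A) (_ : HasFiniteBiproducts A)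
    (_ : Linear k A) (𝓔 : QuillenExactStructure A) (_ : 𝓔.IsFrobenius)
    (Φ : 𝓔.StableCategory ⥤ D) (_ : Φ.IsEquivalence)
    (_ : (𝓔.toStable ⋙ Φ).Additive) (_ : (𝓔.toStable ⋙ Φ).Linear k)
    (δ : ∀ S : ShortComplex A, 𝓔.conflation S →
      ((𝓔.toStable ⋙ Φ).obj S.X₃ ⟶ ((𝓔.toStable ⋙ Φ).obj S.X₁)⟦(1 : ℤ)⟧)),
    (∀ (S T : ShortComplex A) (hS : 𝓔.conflation S) (hT : 𝓔.conflation T) (φ : S ⟶ T),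
      δ S hS ≫ ((𝓔.toStable ⋙ Φ).map φ.τ₁)⟦(1 : ℤ)⟧' = (𝓔.toStable ⋙ Φ).map φ.τ₃ ≫ δ T hT) ∧
    ∀ (S : ShortComplex A) (hS : 𝓔.conflation S),
      Triangle.mk ((𝓔.toStable ⋙ Φ).map S.f) ((𝓔.toStable ⋙ Φ).map S.g) (δ S hS) ∈ distTriang D

end Frobenius

/-! ## The group `G_n = B_n ⋉ ℤⁿ` -/

section BraidGroup

/-- The relations of the Artin braid group on `n` strands, in the generators `b_i`, `i < n - 1`. -/
def braidRels (n : ℕ) : Set (FreeGroup (Fin (n - 1))) :=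
  {x | ∃ i j : Fin (n - 1), (i : ℕ) + 2 ≤ j ∧
    x = FreeGroup.of i * FreeGroup.of j * (FreeGroup.of j * FreeGroup.of i)⁻¹} ∪
  {x | ∃ i j : Fin (n - 1), (i : ℕ) + 1 = j ∧
    x = FreeGroup.of i * FreeGroup.of j * FreeGroup.of i *
      (FreeGroup.of j * FreeGroup.of i * FreeGroup.of j)⁻¹}

/-- Artin's braid group on `n` strands. -/
abbrev BraidGroup (n : ℕ) : Type := PresentedGroup (braidRels n)

/-- The position of the `i`-th generator's first strand. -/
def strandLo {n : ℕ} (i : Fin (n - 1)) : Fin n := ⟨i, by have := i.isLt; omega⟩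

/-- The position of the `i`-th generator's second strand. -/
def strandHi {n : ℕ} (i : Fin (n - 1)) : Fin n := ⟨i + 1, by have := i.isLt; omega⟩

theorem braidRels_perm (n : ℕ) : ∀ r ∈ braidRels n,
    FreeGroup.lift (fun i : Fin (n - 1) => Equiv.swap (strandLo i) (strandHi i)) r = 1 := by
  rintro r (⟨i, j, hij, rfl⟩ | ⟨i, j, hij, rfl⟩)
  · simp only [map_mul, map_inv, FreeGroup.lift_apply_of, mul_inv_eq_one]
    ext x
    simp only [Equiv.Perm.mul_apply, Equiv.swap_apply_def, strandLo, strandHi, Fin.ext_iff]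
    grind
  · simp only [map_mul, map_inv, FreeGroup.lift_apply_of, mul_inv_eq_one]
    ext x
    simp only [Equiv.Perm.mul_apply, Equiv.swap_apply_def, strandLo, strandHi, Fin.ext_iff]
    grind

/-- The homomorphism from the braid group to the symmetric group, `b_i ↦ (i, i+1)`. -/
def braidToPerm (n : ℕ) : BraidGroup n →* Equiv.Perm (Fin n) :=
  PresentedGroup.toGroup (braidRels_perm n)

/-- The semidirect product `G_n = B_n ⋉ ℤⁿ`; the braid group acts on `ℤⁿ` (written
multiplicatively) by permuting the coordinates. -/
abbrev MutationGroup (n : ℕ) : Type :=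
  (Fin n → Multiplicative ℤ) ⋊[mulAutArrow.comp (braidToPerm n)] BraidGroup n

/-- The generator `b_i` of `G_n`. -/
def mutGen {n : ℕ} (i : Fin (n - 1)) : MutationGroup n :=
  SemidirectProduct.inr (PresentedGroup.of i)

/-- The `i`-th standard basis vector `e_i` of `ℤⁿ`, in `G_n`. -/
def shiftGen {n : ℕ} (i : Fin n) : MutationGroup n :=
  SemidirectProduct.inl (Pi.mulSingle i (Multiplicative.ofAdd (1 : ℤ)))

end BraidGroup

/-! ## Triangulated categories: Grothendieck group, Euler form, exceptional collections -/

section Triangulated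

variable (k : Type w) [Field k] (D : Type u) [Category.{v} D] [Preadditive D] [HasZeroObject D]
  [HasShift D ℤ] [∀ n : ℤ, (shiftFunctor D n).Additive] [Pretriangulated D] [Linear k D]

/-- The Grothendieck group of a triangulated category: the free abelian group on the objects
modulo `[X] - [Y] + [Z]` for all distinguished triangles `X ⟶ Y ⟶ Z ⟶ X[1]`. -/
def TriangulatedK0 : Type u :=
  FreeAbelianGroup D ⧸ AddSubgroup.closure
    {x : FreeAbelianGroup D | ∃ T ∈ distTriang D,
      x = FreeAbelianGroup.of T.obj₁ - FreeAbelianGroup.of T.obj₂ + FreeAbelianGroup.of T.obj₃}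

instance : AddCommGroup (TriangulatedK0 D) :=
  inferInstanceAs (AddCommGroup (FreeAbelianGroup D ⧸ AddSubgroup.closure _))

variable {D} in
/-- The class `[X]` of an object in the Grothendieck group. -/
def classK0 (X : D) : TriangulatedK0 D := QuotientAddGroup.mk (FreeAbelianGroup.of X)

/-- `D` is of finite type: the graded `k`-module `⨁_p Hom(X, Y[p])` has finite total dimension
for all `X` and `Y`. -/
class IsOfFiniteType : Prop where
  finite : ∀ X Y : D, Module.Finite k (DirectSum ℤ fun p => (X ⟶ Y⟦p⟧))

/-- `χ` is the Euler form, `χ([X], [Y]) = ∑_p (-1)^p dim_k Hom(X, Y[p])`. Since the classes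
`[X]` generate the Grothendieck group, at most one bilinear form has this property. -/
def IsEulerForm (χ : LinearMap.BilinForm ℤ (TriangulatedK0 D)) : Prop :=
  ∀ X Y : D, χ (classK0 X) (classK0 Y) =
    ∑ᶠ p : ℤ, ((p.negOnePow : ℤˣ) : ℤ) * (Module.finrank k (X ⟶ Y⟦p⟧) : ℤ)

/-- A Serre functor: a `k`-linear autoequivalence `S` with isomorphisms
`Hom(X, Y) ≅ Hom(Y, S X)^*` that are natural in `X` and `Y`. -/
structure SerreFunctor where
  functor : D ⥤ D
  isEquivalence : functor.IsEquivalence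
  additive : functor.Additive
  linear : functor.Linear k
  pairing : ∀ X Y : D, (X ⟶ Y) ≃ₗ[k] Module.Dual k (Y ⟶ functor.obj X)
  natural : ∀ {X X' Y Y' : D} (f : X' ⟶ X) (g : Y ⟶ Y') (h : X ⟶ Y)
    (t : Y' ⟶ functor.obj X'),
    pairing X' Y' (f ≫ h ≫ g) t = pairing X Y h (g ≫ t ≫ functor.map f)

variable {k D} in
/-- The Coxeter functor `S[-1]`. -/
def SerreFunctor.coxeterFunctor (S : SerreFunctor k D) : D ⥤ D :=
  S.functor ⋙ shiftFunctor D (-1 : ℤ)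

variable {D}

/-- `E` is exceptional: `Hom(E, E) = k · id_E` is one-dimensional and `Hom(E, E[p]) = 0` for
`p ≠ 0`. -/
structure IsExceptional (E : D) : Prop where
  end_eq : ∀ f : E ⟶ E, ∃! c : k, f = c • 𝟙 E
  hom_eq_zero : ∀ p : ℤ, p ≠ 0 → ∀ f : E ⟶ E⟦p⟧, f = 0

/-- `(E_1, …, E_n)` is an exceptional collection. -/
structure IsExceptionalCollection {n : ℕ} (E : Fin n → D) : Prop where
  exceptional : ∀ i, IsExceptional k (E i)
  hom_eq_zero : ∀ i j, j < i → ∀ (p : ℤ) (f : E i ⟶ (E j)⟦p⟧), f = 0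

/-- `(E_1, …, E_n)` is a full exceptional collection: the smallest (strictly) full triangulated
subcategory containing all `E_i` is `D`. -/
structure IsFullExceptionalCollection {n : ℕ} (E : Fin n → D) : Prop
    extends IsExceptionalCollection k E where
  full : ∀ P : ObjectProperty D, P.IsTriangulated → P.IsClosedUnderIsomorphisms →
    (∀ i, P (E i)) → ∀ X, P X

/-- The condition on an exceptional collection to be strongly exceptional. -/
def IsStrong {n : ℕ} (E : Fin n → D) : Prop :=
  ∀ (i j : Fin n) (p : ℤ), p ≠ 0 → ∀ f : E i ⟶ (E j)⟦p⟧, f = 0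

end Triangulated

/-! ## Mutations and the action of `G_n` -/

section Mutations

variable (k : Type w) [Field k] {D : Type u} [Category.{v} D] [Preadditive D] [HasZeroObject D]
  [HasShift D ℤ] [∀ n : ℤ, (shiftFunctor D n).Additive] [Pretriangulated D] [Linear k D]

instance finite_hom_shift [hD : IsOfFiniteType k D] (X Y : D) (p : ℤ) :
    Module.Finite k (X ⟶ Y⟦p⟧) := by
  have := hD.finite X Y
  exact Module.Finite.of_surjective (DirectSum.component k ℤ (fun p => (X ⟶ Y⟦p⟧)) p)
    (fun x => ⟨DirectSum.lof k ℤ (fun p => (X ⟶ Y⟦p⟧)) p x, DirectSum.component.lof_self ..⟩)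

/-- An index set for a homogeneous basis of the graded module `Hom^•(X, Y)`. -/
abbrev HomIndex (X Y : D) : Type := Σ p : ℤ, Fin (Module.finrank k (X ⟶ Y⟦p⟧))

instance finite_homIndex [hD : IsOfFiniteType k D] (X Y : D) : Finite (HomIndex k X Y) := by
  have : Module.Finite k (Π₀ p : ℤ, (X ⟶ Y⟦p⟧)) := hD.finite X Y
  exact Module.Finite.finite_basis
    (DFinsupp.basis fun p : ℤ => Module.finBasis k (X ⟶ Y⟦p⟧))

variable [IsOfFiniteType k D]

/-- A homogeneous basis of `Hom^•(X, Y)`. -/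
def homBasis (X Y : D) (j : HomIndex k X Y) : X ⟶ Y⟦j.1⟧ :=
  Module.finBasis k (X ⟶ Y⟦j.1⟧) j.2

/-- The coevaluation `X ⟶ Hom^•(X, Y)^* ⊗ Y`: an element of degree `p` in a homogeneous basis of
`Hom^•(X, Y)` contributes a summand `Y[p]` to the target, and is itself the component of the
coevaluation. -/
def homCoevaluation (X Y : D) : X ⟶ ⨁ fun j : HomIndex k X Y => Y⟦j.1⟧ :=
  biproduct.lift fun j => homBasis k X Y j

/-- The evaluation `Hom^•(X, Y) ⊗ X ⟶ Y`: an element of degree `p` in a homogeneous basis of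
`Hom^•(X, Y)` contributes a summand `X[-p]` to the source, and the component of the evaluation is
the morphism `X[-p] ⟶ Y[p][-p] ≅ Y` obtained from this element. -/
def homEvaluation (X Y : D) : (⨁ fun j : HomIndex k X Y => X⟦-j.1⟧) ⟶ Y :=
  biproduct.desc fun j => (homBasis k X Y j)⟦-j.1⟧' ≫
    (shiftFunctorCompIsoId D j.1 (-j.1) (add_neg_cancel j.1)).hom.app Y

/-- A cone of a morphism (unique up to isomorphism). -/
def coneObj {X Y : D} (f : X ⟶ Y) : D := (distinguished_cocone_triangle f).choose

/-- The right mutation `R_Y X`, the cone of `X ⟶ Hom^•(X, Y)^* ⊗ Y`. -/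
def rightMutation (Y X : D) : D := coneObj (homCoevaluation k X Y)

/-- The left mutation `L_X Y`; its shift `(L_X Y)[1]` is the cone of `Hom^•(X, Y) ⊗ X ⟶ Y`. -/
def leftMutation (X Y : D) : D := (coneObj (homEvaluation k X Y))⟦(-1 : ℤ)⟧

/-- `b_i (E_1, …, E_n) = (…, E_{i-1}, E_{i+1}, R_{E_{i+1}} E_i, E_{i+2}, …)`. -/
def braidMove {n : ℕ} (i : Fin (n - 1)) (E : Fin n → D) : Fin n → D :=
  fun j => if j = strandLo i then E (strandHi i)
    else if j = strandHi i then rightMutation k (E (strandHi i)) (E (strandLo i))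
    else E j

/-- `b_i⁻¹ (E_1, …, E_n) = (…, E_{i-1}, L_{E_i} E_{i+1}, E_i, E_{i+2}, …)`. -/
def braidInvMove {n : ℕ} (i : Fin (n - 1)) (E : Fin n → D) : Fin n → D :=
  fun j => if j = strandLo i then leftMutation k (E (strandLo i)) (E (strandHi i))
    else if j = strandHi i then E (strandLo i)
    else E j

/-- The full exceptional collections of length `n`. -/
abbrev FullExceptionalCollection (D : Type u) [Category.{v} D] [Preadditive D] [HasZeroObject D]
    [HasShift D ℤ] [∀ n : ℤ, (shiftFunctor D n).Additive] [Pretriangulated D] [Linear k D]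
    (n : ℕ) : Type u :=
  {E : Fin n → D // IsFullExceptionalCollection k E}

/-- The graph of the action of `G_n` on isomorphism classes of full exceptional collections:
`MutationAction k g E F` means that `g` maps the isomorphism class of `E` to the one of `F`. It is
generated by the formulas for the action of `1`, of `b_i` and `b_i⁻¹` (mutations) and of `e_i`
and `e_i⁻¹` (translations). -/
inductive MutationAction {n : ℕ} :
    MutationGroup n → FullExceptionalCollection k D n → FullExceptionalCollection k D n → Prop
  | one {E F : FullExceptionalCollection k D n} (h : ∀ j, Nonempty (F.1 j ≅ E.1 j)) :
      MutationAction 1 E F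
  | braid {g : MutationGroup n} {E F F' : FullExceptionalCollection k D n} (i : Fin (n - 1))
      (hF : MutationAction g E F) (h : ∀ j, Nonempty (F'.1 j ≅ braidMove k i F.1 j)) :
      MutationAction (mutGen i * g) E F'
  | braidInv {g : MutationGroup n} {E F F' : FullExceptionalCollection k D n} (i : Fin (n - 1))
      (hF : MutationAction g E F) (h : ∀ j, Nonempty (F'.1 j ≅ braidInvMove k i F.1 j)) :
      MutationAction ((mutGen i)⁻¹ * g) E F'
  | shift {g : MutationGroup n} {E F F' : FullExceptionalCollection k D n} (i : Fin n)
      (hF : MutationAction g E F)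
      (h : ∀ j, Nonempty (F'.1 j ≅ if j = i then (F.1 j)⟦(1 : ℤ)⟧ else F.1 j)) :
      MutationAction (shiftGen i * g) E F'
  | shiftInv {g : MutationGroup n} {E F F' : FullExceptionalCollection k D n} (i : Fin n)
      (hF : MutationAction g E F)
      (h : ∀ j, Nonempty (F'.1 j ≅ if j = i then (F.1 j)⟦(-1 : ℤ)⟧ else F.1 j)) :
      MutationAction ((shiftGen i)⁻¹ * g) E F'

variable (D) in
/-- The action of `G_n` on the set of isomorphism classes of full exceptional collections of
length `n` is transitive. -/
def MutationTransitive (n : ℕ) : Prop :=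
  ∀ E F : FullExceptionalCollection k D n, ∃ g : MutationGroup n, MutationAction k g E F

end Mutations

/-! ## The root system data of a triangulated category -/

section RootData

variable {D : Type u} [Category.{v} D] [Preadditive D] [HasZeroObject D]
  [HasShift D ℤ] [∀ n : ℤ, (shiftFunctor D n).Additive] [Pretriangulated D]

/-- The Cartan form `I(x, y) = χ(x, y) + χ(y, x)`. -/
def cartanForm (χ : LinearMap.BilinForm ℤ (TriangulatedK0 D)) :
    LinearMap.BilinForm ℤ (TriangulatedK0 D) :=
  χ + χ.flip

/-- The real roots `W(B) B` with `B = {[E_1], …, [E_n]}`. -/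
def realRoots (I : LinearMap.BilinForm ℤ (TriangulatedK0 D)) {n : ℕ} (E : Fin n → D) :
    Set (TriangulatedK0 D) :=
  reflectionOrbit I (Set.range fun i => classK0 (E i))

end RootData

end

/-! The proof splits into lattice theory and duality, joined by one fact: in the classes of a full
exceptional collection the Euler form has an upper unitriangular Gram matrix.

The form exists because alternating sums of dimensions vanish on the long exact sequences of a
triangle (`altSum_left`, `altSum_right`). Fullness makes the classes span (`span_classK0_eq_top`),
and unitriangularity makes them independent. The rest of the root system structure follows from norm
two and the conjugation rule `rootReflectionEquiv_map`.

For the Serre functor, an object `R` and a form on `Hom(X, R)` are built for each `X` so that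
composition `Hom(X, Y) × Hom(Y, R) → k` is perfect. `IsExceptionalFamily.extend_represents` secures
this on the translates of one more member of the collection at a time, and the five lemma carries it
to every `Y`. The same construction in the opposite category gives essential surjectivity.

For the Coxeter element, unitriangularity alone gives `χ(e_i, c x) = -χ(x, e_i)` for `c = r_{e_1} ⋯
r_{e_n}` (`IsUnitriangular.coxeter_spec`). Serre duality gives the same identity for `S[-1]`, and
`χ` is nondegenerate, so the two agree for every choice of `S`
(`IsFullExceptionalCollection.coxeter_classK0`).

For independence of the collection, a mutation replaces the classes `(α, β)` by `(β, -r_β α)` or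
`(-r_α β, α)`, and a translation changes a sign. Neither changes `W(B)B`, so transitivity finishes
the proof (`MutationAction.realRoots_eq`), once all full collections are known to have the same
length. -/

noncomputable section

set_option linter.unusedSectionVars false

/-! ### Reflection groups and their root orbits in a lattice -/

section RootLattice

variable {K : Type*} [AddCommGroup K]

theorem rootReflection_apply (I : LinearMap.BilinForm ℤ K) (α x : K) :
    rootReflection I α x = x - I x α • α := by
  simp [rootReflection, Module.preReflection_apply]

theorem rootReflection_self (I : LinearMap.BilinForm ℤ K) {α : K} (h : I α α = 2) :
    rootReflection I α α = -α := by
  rw [rootReflection_apply, h, two_smul]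
  abel

theorem rootReflection_rootReflection (I : LinearMap.BilinForm ℤ K) {α : K} (h : I α α = 2)
    (x : K) : rootReflection I α (rootReflection I α x) = x := by
  simp only [rootReflection_apply, map_sub, map_zsmul, h]
  module

/-- The reflection in a vector of norm two, as an automorphism. -/
def rootReflectionEquiv (I : LinearMap.BilinForm ℤ K) {α : K} (h : I α α = 2) : K ≃ₗ[ℤ] K :=
  LinearEquiv.ofInvolutive (rootReflection I α) (rootReflection_rootReflection I h)

theorem rootReflectionEquiv_apply (I : LinearMap.BilinForm ℤ K) {α : K} (h : I α α = 2) (x : K) :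
    rootReflectionEquiv I h x = rootReflection I α x := rfl

theorem rootReflectionEquiv_mem_isometryGroup {I : LinearMap.BilinForm ℤ K}
    (hI : ∀ x y, I x y = I y x) {α : K} (h : I α α = 2) :
    rootReflectionEquiv I h ∈ isometryGroup I := by
  intro x y
  simp only [rootReflectionEquiv_apply, rootReflection_apply, map_sub, map_zsmul,
    LinearMap.sub_apply, LinearMap.smul_apply, h, smul_eq_mul, hI α y]
  ring

theorem rootReflectionEquiv_mem_reflectionGroup {I : LinearMap.BilinForm ℤ K}
    (hI : ∀ x y, I x y = I y x) {S : Set K} {α : K} (hα : α ∈ S) (h : I α α = 2) :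
    rootReflectionEquiv I h ∈ reflectionGroup I S :=
  Subgroup.subset_closure ⟨rootReflectionEquiv_mem_isometryGroup hI h, α, hα, rfl⟩

theorem reflectionGroup_le_isometryGroup (I : LinearMap.BilinForm ℤ K) (S : Set K) :
    reflectionGroup I S ≤ isometryGroup I :=
  (Subgroup.closure_le _).2 fun _ h => h.1

/-- To bound a reflection group it suffices to bound the reflections which generate it. -/
theorem reflectionGroup_le {I : LinearMap.BilinForm ℤ K} {S : Set K} (hS : ∀ α ∈ S, I α α = 2)
    {G : Subgroup (K ≃ₗ[ℤ] K)} (h : ∀ α (hα : α ∈ S), rootReflectionEquiv I (hS α hα) ∈ G) :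
    reflectionGroup I S ≤ G := by
  refine (Subgroup.closure_le _).2 ?_
  rintro g ⟨-, α, hα, hg⟩
  have : g = rootReflectionEquiv I (hS α hα) := LinearEquiv.toLinearMap_injective hg
  rw [this]
  exact h α hα

/-- Conjugation rule `r_{gα} = g r_α g⁻¹`, checked at `x = g y`. It puts the reflection in every
root of `W(S)S` into `W(S)`. -/
theorem rootReflectionEquiv_map {I : LinearMap.BilinForm ℤ K} {g : K ≃ₗ[ℤ] K}
    (hg : g ∈ isometryGroup I) {α : K} (h : I α α = 2) (h' : I (g α) (g α) = 2) :
    rootReflectionEquiv I h' = g * rootReflectionEquiv I h * g⁻¹ := by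
  ext x
  obtain ⟨y, rfl⟩ := g.surjective x
  have : g⁻¹ (g y) = y := g.symm_apply_apply y
  simp only [LinearEquiv.mul_apply, this, rootReflectionEquiv_apply, rootReflection_apply, map_sub,
    map_zsmul, hg y α]

theorem norm_reflectionOrbit {I : LinearMap.BilinForm ℤ K} {S : Set K}
    (hS : ∀ α ∈ S, I α α = 2) : ∀ α ∈ reflectionOrbit I S, I α α = 2 := by
  rintro _ ⟨g, hg, β, hβ, rfl⟩
  rw [reflectionGroup_le_isometryGroup I S hg, hS β hβ]

theorem subset_reflectionOrbit (I : LinearMap.BilinForm ℤ K) (S : Set K) :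
    S ⊆ reflectionOrbit I S := fun α hα => ⟨1, one_mem _, α, hα, rfl⟩

theorem map_mem_reflectionOrbit {I : LinearMap.BilinForm ℤ K} {S : Set K} {g : K ≃ₗ[ℤ] K}
    (hg : g ∈ reflectionGroup I S) {x : K} (hx : x ∈ reflectionOrbit I S) :
    g x ∈ reflectionOrbit I S := by
  obtain ⟨h, hh, β, hβ, rfl⟩ := hx
  exact ⟨g * h, mul_mem hg hh, β, hβ, rfl⟩

theorem neg_mem_reflectionOrbit {I : LinearMap.BilinForm ℤ K} (hI : ∀ x y, I x y = I y x)
    {S : Set K} (hS : ∀ α ∈ S, I α α = 2) {x : K} (hx : x ∈ reflectionOrbit I S) :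
    -x ∈ reflectionOrbit I S := by
  obtain ⟨h, hh, β, hβ, rfl⟩ := hx
  refine ⟨h * rootReflectionEquiv I (hS β hβ),
    mul_mem hh (rootReflectionEquiv_mem_reflectionGroup hI hβ _), β, hβ, ?_⟩
  rw [LinearEquiv.mul_apply, rootReflectionEquiv_apply, rootReflection_self I (hS β hβ), map_neg]

theorem rootReflectionEquiv_mem_of_mem_reflectionOrbit {I : LinearMap.BilinForm ℤ K}
    (hI : ∀ x y, I x y = I y x) {S : Set K} (hS : ∀ α ∈ S, I α α = 2) {α : K}
    (hα : α ∈ reflectionOrbit I S) (h : I α α = 2) :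
    rootReflectionEquiv I h ∈ reflectionGroup I S := by
  obtain ⟨g, hg, β, hβ, rfl⟩ := hα
  rw [rootReflectionEquiv_map (reflectionGroup_le_isometryGroup I S hg) (hS β hβ)]
  exact mul_mem (mul_mem hg (rootReflectionEquiv_mem_reflectionGroup hI hβ _)) (inv_mem hg)

theorem reflectionGroup_reflectionOrbit {I : LinearMap.BilinForm ℤ K}
    (hI : ∀ x y, I x y = I y x) {S : Set K} (hS : ∀ α ∈ S, I α α = 2) :
    reflectionGroup I (reflectionOrbit I S) = reflectionGroup I S := by
  refine le_antisymm (reflectionGroup_le (norm_reflectionOrbit hS) fun α hα =>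
    rootReflectionEquiv_mem_of_mem_reflectionOrbit hI hS hα _) (reflectionGroup_le hS fun α hα =>
    rootReflectionEquiv_mem_reflectionGroup hI (subset_reflectionOrbit I S hα) _)

/-- By conjugation the reflections in `S` already lie in `W(T)`, so comparing two orbits reduces to
comparing their generators. -/
theorem reflectionOrbit_subset {I : LinearMap.BilinForm ℤ K}
    (hI : ∀ x y, I x y = I y x) {S T : Set K} (hS : ∀ α ∈ S, I α α = 2) (hT : ∀ α ∈ T, I α α = 2)
    (h : S ⊆ reflectionOrbit I T) : reflectionOrbit I S ⊆ reflectionOrbit I T := by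
  have hle : reflectionGroup I S ≤ reflectionGroup I T := reflectionGroup_le hS fun α hα =>
    rootReflectionEquiv_mem_of_mem_reflectionOrbit hI hT (h hα) _
  rintro _ ⟨g, hg, β, hβ, rfl⟩
  exact map_mem_reflectionOrbit (hle hg) (h hβ)

theorem reflectionOrbit_eq {I : LinearMap.BilinForm ℤ K}
    (hI : ∀ x y, I x y = I y x) {S T : Set K} (hS : ∀ α ∈ S, I α α = 2) (hT : ∀ α ∈ T, I α α = 2)
    (h : S ⊆ reflectionOrbit I T) (h' : T ⊆ reflectionOrbit I S) :
    reflectionOrbit I S = reflectionOrbit I T :=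
  (reflectionOrbit_subset hI hS hT h).antisymm (reflectionOrbit_subset hI hT hS h')

theorem reflectionOrbit_range_eq_of_sign {I : LinearMap.BilinForm ℤ K} (hI : ∀ x y, I x y = I y x)
    {ι : Type*} {a b : ι → K} (ha : ∀ i, I (a i) (a i) = 2) (h : ∀ i, b i = a i ∨ b i = -a i) :
    reflectionOrbit I (Set.range b) = reflectionOrbit I (Set.range a) := by
  have hb : ∀ i, I (b i) (b i) = 2 := fun i => by
    rcases h i with h | h <;> simp [h, ha]
  have ha' : ∀ α ∈ Set.range a, I α α = 2 := by rintro _ ⟨i, rfl⟩; exact ha i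
  have hb' : ∀ α ∈ Set.range b, I α α = 2 := by rintro _ ⟨i, rfl⟩; exact hb i
  refine reflectionOrbit_eq hI hb' ha' ?_ ?_
  · rintro _ ⟨i, rfl⟩
    have := subset_reflectionOrbit I _ (Set.mem_range_self (f := a) i)
    rcases h i with h | h <;> rw [h]
    · exact this
    · exact neg_mem_reflectionOrbit hI ha' this
  · rintro _ ⟨i, rfl⟩
    have := subset_reflectionOrbit I _ (Set.mem_range_self (f := b) i)
    rcases h i with h | h
    · rwa [← h]
    · rw [← neg_neg (a i), ← h]
      exact neg_mem_reflectionOrbit hI hb' this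

/-- Replacing a pair `(α, β)` in a family by `(β, -r_β α)` does not change the real roots. -/
theorem reflectionOrbit_range_eq_of_mutation {I : LinearMap.BilinForm ℤ K}
    (hI : ∀ x y, I x y = I y x) {ι : Type*} {a b : ι → K} (ha : ∀ i, I (a i) (a i) = 2)
    {s t s' t' : ι} (hs' : b s' = a t)
    (ht' : b t' = -rootReflection I (a t) (a s))
    (hperm : ({s', t'} : Set ι) = {s, t})
    (h : ∀ j, j ≠ s → j ≠ t → b j = a j) :
    reflectionOrbit I (Set.range b) = reflectionOrbit I (Set.range a) := by
  have ha' : ∀ α ∈ Set.range a, I α α = 2 := by rintro _ ⟨i, rfl⟩; exact ha i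
  have hcase : ∀ j, j = s' ∨ j = t' ∨ (j ≠ s ∧ j ≠ t) := fun j => by
    have : j ∈ ({s', t'} : Set ι) ↔ j ∈ ({s, t} : Set ι) := by rw [hperm]
    simp only [Set.mem_insert_iff, Set.mem_singleton_iff] at this
    tauto
  have hba : Set.range b ⊆ reflectionOrbit I (Set.range a) := by
    rintro _ ⟨j, rfl⟩
    rcases hcase j with rfl | rfl | ⟨h1, h2⟩
    · rw [hs']; exact subset_reflectionOrbit _ _ (Set.mem_range_self _)
    · rw [ht', ← rootReflectionEquiv_apply I (ha t)]
      exact neg_mem_reflectionOrbit hI ha' (map_mem_reflectionOrbit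
        (rootReflectionEquiv_mem_reflectionGroup hI (Set.mem_range_self _) _)
        (subset_reflectionOrbit _ _ (Set.mem_range_self _)))
    · rw [h j h1 h2]; exact subset_reflectionOrbit _ _ (Set.mem_range_self _)
  have hb' : ∀ α ∈ Set.range b, I α α = 2 := fun α hα => norm_reflectionOrbit ha' α (hba hα)
  refine reflectionOrbit_eq hI hb' ha' hba ?_
  rintro _ ⟨j, rfl⟩
  by_cases h1 : j = s
  -- The substitution inverts itself up to roles: `r_{a t}` is an involution and `b s' = a t`, so `a
  -- s` is recovered by the same formula.
  · have : a j = -rootReflection I (b s') (b t') := by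
      rw [hs', ht', map_neg, rootReflection_rootReflection I (ha t), neg_neg, h1]
    rw [this, ← rootReflectionEquiv_apply I (hb' _ (Set.mem_range_self s'))]
    exact neg_mem_reflectionOrbit hI hb' (map_mem_reflectionOrbit
        (rootReflectionEquiv_mem_reflectionGroup hI (Set.mem_range_self _) _)
        (subset_reflectionOrbit _ _ (Set.mem_range_self _)))
  · by_cases h2 : j = t
    · rw [h2, ← hs']; exact subset_reflectionOrbit _ _ (Set.mem_range_self _)
    · rw [← h j h1 h2]; exact subset_reflectionOrbit _ _ (Set.mem_range_self _)

end RootLattice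

/-! ### Lattices with a unitriangular form -/

section UnitriangularForm

variable {K : Type*} [AddCommGroup K] {n : ℕ}

/-- The Gram matrix of `χ` with respect to `e` is upper triangular with ones on the diagonal. -/
structure IsUnitriangular (χ : LinearMap.BilinForm ℤ K) (e : Fin n → K) : Prop where
  diag : ∀ i, χ (e i) (e i) = 1
  lower : ∀ i j, j < i → χ (e i) (e j) = 0

namespace IsUnitriangular

variable {χ : LinearMap.BilinForm ℤ K} {e : Fin n → K} (h : IsUnitriangular χ e)
include h

/-- Pair with `e m` for the largest `m` with `a m ≠ 0`: smaller indices are killed by triangularity,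
larger ones by maximality, and `a m` remains. -/
theorem coeff_eq_zero (a : Fin n → ℤ) (ha : ∀ i, χ (e i) (∑ j, a j • e j) = 0) : a = 0 := by
  by_contra hne
  obtain ⟨i, hi⟩ : ∃ i, a i ≠ 0 := Function.ne_iff.1 hne
  obtain ⟨m, hm, hmax⟩ := (Finset.univ.filter fun i => a i ≠ 0).exists_max_image id
    ⟨i, by simpa using hi⟩
  have := ha m
  rw [map_sum, Finset.sum_eq_single m] at this
  · simp [h.diag] at this
    simp [this] at hm
  · intro j _ hj
    rcases lt_or_gt_of_ne hj with hj | hj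
    · simp [h.lower m j hj]
    · have : a j = 0 := by
        by_contra h0
        exact absurd (hmax j (by simpa using h0)) (not_le.2 hj)
      simp [this]
  · simp

theorem linearIndependent : LinearIndependent ℤ e := by
  rw [Fintype.linearIndependent_iff]
  intro a ha i
  exact congrFun (h.coeff_eq_zero a fun i => by simp [ha]) i

theorem eq_zero_of_right (hspan : Submodule.span ℤ (Set.range e) = ⊤) (x : K)
    (hx : ∀ i, χ (e i) x = 0) : x = 0 := by
  obtain ⟨a, rfl⟩ := (Submodule.mem_span_range_iff_exists_fun ℤ).1
    (hspan ▸ Submodule.mem_top : x ∈ Submodule.span ℤ (Set.range e))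
  simp [h.coeff_eq_zero a hx]

theorem norm_eq_two (i : Fin n) : (χ + χ.flip) (e i) (e i) = 2 := by
  simp [h.diag]

/-- Induction that peels off `e 0`, the reflection applied last. The tail changes `x` only within
the span of the later `e i`, where `χ(·, e 0)` vanishes; the first conjunct records this for the
induction. Then `r_{e 0}` turns `χ(e 0, y)` into `-χ(y, e 0) = -χ(x, e 0)` and leaves the values at
later indices alone. -/
theorem coxeter_spec (x : K) :
    (List.ofFn fun i => (rootReflection (χ + χ.flip) (e i) : Module.End ℤ K)).prod x - x ∈
      Submodule.span ℤ (Set.range e) ∧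
    ∀ i, χ (e i) ((List.ofFn fun i =>
      (rootReflection (χ + χ.flip) (e i) : Module.End ℤ K)).prod x) = -χ x (e i) := by
  induction n with
  | zero => exact ⟨by simp, fun i => i.elim0⟩
  | succ n ih =>
    have htail : IsUnitriangular χ (fun i : Fin n => e i.succ) :=
      ⟨fun i => h.diag _, fun i j hij => h.lower _ _ (Fin.succ_lt_succ_iff.2 hij)⟩
    obtain ⟨hmem, hval⟩ := ih htail
    rw [List.ofFn_succ, List.prod_cons, Module.End.mul_apply, rootReflection_apply]
    set y := (List.ofFn fun i : Fin n =>
      (rootReflection (χ + χ.flip) (e i.succ) : Module.End ℤ K)).prod x with hy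
    have hy0 : χ y (e 0) = χ x (e 0) := by
      have hle : Submodule.span ℤ (Set.range fun i : Fin n => e i.succ) ≤
          LinearMap.ker (χ.flip (e 0)) := by
        rw [Submodule.span_le]
        rintro _ ⟨i, rfl⟩
        simpa using h.lower _ _ (Fin.succ_pos i)
      have := hle hmem
      rw [LinearMap.mem_ker, map_sub, sub_eq_zero] at this
      exact this
    refine ⟨?_, fun i => ?_⟩
    · rw [sub_right_comm]
      refine Submodule.sub_mem _ (Submodule.span_mono ?_ hmem)
        (Submodule.smul_mem _ _ (Submodule.subset_span ⟨0, rfl⟩))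
      rintro _ ⟨i, rfl⟩
      exact ⟨_, rfl⟩
    · refine Fin.cases ?_ (fun j => ?_) i
      · simp [h.diag, hy0]
      · simp [h.lower _ _ (Fin.succ_pos j), hval j]

/-- The product `r_{e_1} ⋯ r_{e_n}` of the reflections in a unitriangular family. -/
def coxeter : K ≃ₗ[ℤ] K :=
  (List.ofFn fun i => rootReflectionEquiv (χ + χ.flip) (h.norm_eq_two i)).prod

theorem coe_coxeter : (h.coxeter : K →ₗ[ℤ] K) =
    (List.ofFn fun i => (rootReflection (χ + χ.flip) (e i) : Module.End ℤ K)).prod := by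
  have := map_list_prod (LinearEquiv.automorphismGroup.toLinearMapMonoidHom (R := ℤ) (M := K))
    (List.ofFn fun i => rootReflectionEquiv (χ + χ.flip) (h.norm_eq_two i))
  rw [List.map_ofFn] at this
  exact this

theorem form_coxeter (i : Fin n) (x : K) : χ (e i) (h.coxeter x) = -χ x (e i) := by
  rw [← (h.coxeter_spec x).2 i, ← h.coe_coxeter]
  rfl

theorem coxeter_mem : h.coxeter ∈ reflectionGroup (χ + χ.flip) (Set.range e) := by
  refine Subgroup.list_prod_mem _ fun g hg => ?_
  obtain ⟨i, rfl⟩ := (List.mem_ofFn' _ _).1 hg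
  exact rootReflectionEquiv_mem_reflectionGroup (fun x y => add_comm _ _)
    (Set.mem_range_self i) _

theorem isRootBasis (hspan : Submodule.span ℤ (Set.range e) = ⊤) :
    IsRootBasis (χ + χ.flip) (reflectionOrbit (χ + χ.flip) (Set.range e)) e := by
  have hI : ∀ x y, (χ + χ.flip) x y = (χ + χ.flip) y x := fun x y => add_comm _ _
  have hnorm : ∀ α ∈ Set.range e, (χ + χ.flip) α α = 2 := by
    rintro _ ⟨i, rfl⟩; exact h.norm_eq_two i
  have hgrp := reflectionGroup_reflectionOrbit hI hnorm
  refine ⟨fun i => subset_reflectionOrbit _ _ (Set.mem_range_self i), h.linearIndependent, hspan,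
    hgrp, ?_⟩
  rw [hgrp]
  ext x
  simp [reflectionOrbit]

/-- A lattice with a spanning unitriangular family is a simply-laced generalized root system. -/
theorem isSimplyLacedGRS (hspan : Submodule.span ℤ (Set.range e) = ⊤) :
    IsSimplyLacedGRS (χ + χ.flip) (reflectionOrbit (χ + χ.flip) (Set.range e)) h.coxeter := by
  have hI : ∀ x y, (χ + χ.flip) x y = (χ + χ.flip) y x := fun x y => add_comm _ _
  have hnorm : ∀ α ∈ Set.range e, (χ + χ.flip) α α = 2 := by
    rintro _ ⟨i, rfl⟩; exact h.norm_eq_two i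
  have hgrp := reflectionGroup_reflectionOrbit hI hnorm
  let b : Module.Basis (Fin n) ℤ K := Module.Basis.mk h.linearIndependent hspan.ge
  refine ⟨Module.Free.of_basis b, Module.Finite.of_basis b, hI, ?_, norm_reflectionOrbit hnorm, ?_,
    ⟨n, e, h.isRootBasis hspan⟩, hgrp ▸ h.coxeter_mem, n, e, h.isRootBasis hspan, h.coe_coxeter⟩
  · exact eq_top_iff.2 (hspan.ge.trans (Submodule.span_mono (subset_reflectionOrbit _ _)))
  · intro α hα
    have h2 := norm_reflectionOrbit hnorm α hα
    have hmaps : ∀ x ∈ reflectionOrbit (χ + χ.flip) (Set.range e),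
        rootReflection (χ + χ.flip) α x ∈ reflectionOrbit (χ + χ.flip) (Set.range e) := fun x hx =>
      map_mem_reflectionOrbit (rootReflectionEquiv_mem_of_mem_reflectionOrbit hI hnorm hα h2) hx
    refine Set.Subset.antisymm (Set.image_subset_iff.2 hmaps) fun x hx => ?_
    exact ⟨_, hmaps x hx, rootReflection_rootReflection _ h2 x⟩

end IsUnitriangular

end UnitriangularForm

/-! ### Alternating sums of dimensions -/

section AlternatingSums

/-- The alternating sum of a family of natural numbers indexed by the integers. -/
def altSum (a : ℤ → ℕ) : ℤ := ∑ᶠ p : ℤ, ((p.negOnePow : ℤˣ) : ℤ) * (a p : ℤ)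

theorem altSum_succ (a : ℤ → ℕ) : altSum (fun p => a (p + 1)) = -altSum a := by
  have h := finsum_comp_equiv (Equiv.addRight (1 : ℤ))
    (f := fun p : ℤ => ((p.negOnePow : ℤˣ) : ℤ) * (a p : ℤ))
  rw [altSum, altSum, ← h, ← finsum_neg_distrib]
  refine finsum_congr fun p => ?_
  simp [Int.negOnePow_succ]

theorem finite_support_altSum {a : ℤ → ℕ} (ha : a.support.Finite) :
    (Function.support fun p : ℤ => ((p.negOnePow : ℤˣ) : ℤ) * (a p : ℤ)).Finite :=
  ha.subset fun p hp h => hp (by simp [h])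

theorem altSum_add {a b : ℤ → ℕ} (ha : a.support.Finite) (hb : b.support.Finite) :
    altSum (fun p => a p + b p) = altSum a + altSum b := by
  rw [altSum, altSum, altSum,
    ← finsum_add_distrib (finite_support_altSum ha) (finite_support_altSum hb)]
  exact finsum_congr fun p => by push_cast; ring

/-- The alternating sum of the dimensions in a long exact sequence; `κ` are the dimensions of the
kernels of its first maps. -/
theorem altSum_eq_zero_of_exact {a b c κ : ℤ → ℕ} (ha : a.support.Finite) (hb : b.support.Finite)
    (hc : c.support.Finite) (hκ : κ.support.Finite)
    (h : ∀ p, a p + c p = b p + (κ p + κ (p + 1))) : altSum a - altSum b + altSum c = 0 := by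
  have hκ' : (Function.support fun p => κ (p + 1)).Finite :=
    hκ.preimage (f := fun p => p + 1) (add_left_injective 1).injOn
  have h1 := altSum_add ha hc
  have h2 := altSum_add (a := b) (b := fun p => κ p + κ (p + 1)) hb
    ((hκ.union hκ').subset fun p hp => by
      simp only [Function.mem_support, Set.mem_union] at hp ⊢
      omega)
  have h3 := altSum_add hκ hκ'
  -- The kernel terms `κ p` and `κ (p + 1)` cancel, because the shift reverses the sign.
  rw [altSum_succ] at h3
  rw [funext h, h2, h3] at h1
  linarith

/-- Rank-nullity, written with kernels only, so that consecutive terms of a long exact sequence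
share a summand. -/
theorem finrank_eq_add_of_exact {k U V W : Type*} [Field k] [AddCommGroup U] [Module k U]
    [AddCommGroup V] [Module k V] [AddCommGroup W] [Module k W] [Module.Finite k U]
    (f : U →ₗ[k] V) (g : V →ₗ[k] W) (h : LinearMap.range f = LinearMap.ker g) :
    Module.finrank k U = Module.finrank k (LinearMap.ker f) +
      Module.finrank k (LinearMap.ker g) := by
  rw [← h, add_comm, LinearMap.finrank_range_add_finrank_ker]

theorem finrank_ker_eq_of_equiv {k U V U' V' : Type*} [Field k] [AddCommGroup U] [Module k U]
    [AddCommGroup V] [Module k V] [AddCommGroup U'] [Module k U'] [AddCommGroup V'] [Module k V']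
    (f : U →ₗ[k] V) (f' : U' →ₗ[k] V') (e : U ≃ₗ[k] U')
    (h : ∀ x, f x = 0 ↔ f' (e x) = 0) :
    Module.finrank k (LinearMap.ker f) = Module.finrank k (LinearMap.ker f') := by
  refine (e.submoduleMap (LinearMap.ker f)).finrank_eq.trans ?_
  have : Submodule.map (e : U →ₗ[k] U') (LinearMap.ker f) = LinearMap.ker f' := by
    ext x
    obtain ⟨y, rfl⟩ := e.surjective x
    simp [h]
  exact (LinearEquiv.ofEq _ _ this).finrank_eq

end AlternatingSums

/-! ### Classes in the Grothendieck group -/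

section GrothendieckGroup

/-- A biproduct indexed by `Option J` splits off the summand of index `none`. -/
def biproductOptionIso {C : Type*} [Category* C] [Preadditive C] [HasFiniteBiproducts C]
    [HasBinaryBiproducts C] {J : Type} [Fintype J] (F : Option J → C) :
    ⨁ F ≅ F none ⊞ ⨁ fun j => F (some j) where
  hom := biprod.lift (biproduct.π F none) (biproduct.lift fun j => biproduct.π F (some j))
  inv := biprod.desc (biproduct.ι F none) (biproduct.desc fun j => biproduct.ι F (some j))
  hom_inv_id := by
    rw [biprod.lift_desc, biproduct.lift_desc, ← biproduct.total, Fintype.sum_option]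
  inv_hom_id := by
    classical
    refine biprod.hom_ext' _ _ (biprod.hom_ext _ _ ?_ (biproduct.hom_ext _ _ fun j => ?_))
      (biproduct.hom_ext' _ _ fun i => biprod.hom_ext _ _ ?_ (biproduct.hom_ext _ _ fun j => ?_))
      <;> simp [biproduct.ι_π]
open ZeroObject

variable (k : Type w) [Field k] {D : Type u} [Category.{v} D] [Preadditive D] [HasZeroObject D]
  [HasShift D ℤ] [∀ n : ℤ, (shiftFunctor D n).Additive] [Pretriangulated D] [Linear k D]

theorem classK0_triangle {T : Triangle D} (hT : T ∈ distTriang D) :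
    classK0 T.obj₁ - classK0 T.obj₂ + classK0 T.obj₃ = 0 :=
  (QuotientAddGroup.eq_zero_iff _).2 (AddSubgroup.subset_closure ⟨T, hT, rfl⟩)

theorem classK0_obj₂ {T : Triangle D} (hT : T ∈ distTriang D) :
    classK0 T.obj₂ = classK0 T.obj₁ + classK0 T.obj₃ := by
  have := classK0_triangle hT
  rw [sub_add_eq_add_sub, sub_eq_zero] at this
  exact this.symm

/-- The triangle `0 → 0 → 0` gives `[0] = 0`, and `X → 0 → 0` then gives `[X] = 0`. Isomorphism
invariance of classes is not yet available here; it is deduced from this lemma. -/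
theorem classK0_of_isZero {X : D} (hX : IsZero X) : classK0 X = 0 := by
  have h := classK0_obj₂ (contractible_distinguished (0 : D))
  simp only [contractibleTriangle_obj₁, contractibleTriangle_obj₂, contractibleTriangle_obj₃] at h
  have h' := classK0_obj₂ (isomorphic_distinguished _ (contractible_distinguished (0 : D))
    (Triangle.mk (0 : X ⟶ 0) (0 : (0 : D) ⟶ 0) 0) (Triangle.isoMk _ _
      (hX.iso (isZero_zero D)) (Iso.refl _) (Iso.refl _) ((isZero_zero D).eq_of_tgt _ _)
      ((isZero_zero D).eq_of_tgt _ _) ((isZero_zero D).eq_of_src _ _)))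
  simp only [Triangle.mk_obj₁, Triangle.mk_obj₂, Triangle.mk_obj₃] at h'
  have h0 : classK0 (0 : D) = 0 := by simpa using h
  simpa [h0] using h'.symm

theorem classK0_eq_of_iso {X Y : D} (e : X ≅ Y) : classK0 X = classK0 Y := by
  have h := classK0_obj₂ ((Triangle.distinguished_iff_of_isZero₃ (Triangle.mk e.hom (0 : Y ⟶ 0) 0)
    (isZero_zero D)).2 (inferInstanceAs (IsIso e.hom)))
  simp only [Triangle.mk_obj₁, Triangle.mk_obj₂, Triangle.mk_obj₃,
    classK0_of_isZero (isZero_zero D), add_zero] at h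
  exact h.symm

theorem classK0_shift_one (X : D) : classK0 (X⟦(1 : ℤ)⟧) = -classK0 X := by
  have h := classK0_obj₂ (rot_of_distTriang _ (contractible_distinguished X))
  simp only [Triangle.rotate_obj₁, Triangle.rotate_obj₂, Triangle.rotate_obj₃,
    contractibleTriangle_obj₁, contractibleTriangle_obj₂, contractibleTriangle_obj₃,
    classK0_of_isZero (isZero_zero D)] at h
  exact (neg_eq_of_add_eq_zero_right h.symm).symm

theorem classK0_shift (X : D) (p : ℤ) :
    classK0 (X⟦p⟧) = ((p.negOnePow : ℤˣ) : ℤ) • classK0 X := by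
  have hs : ∀ q : ℤ, classK0 (X⟦q + 1⟧) = -classK0 (X⟦q⟧) := fun q => by
    rw [classK0_eq_of_iso ((shiftFunctorAdd D q 1).app X)]
    exact classK0_shift_one _
  induction p using Int.induction_on with
  | zero => simpa using classK0_eq_of_iso ((shiftFunctorZero D ℤ).app X)
  | succ n ih => rw [hs, ih, Int.negOnePow_succ]; simp
  | pred n ih =>
    have := hs (-n - 1)
    rw [sub_add_cancel, ih] at this
    rw [← neg_eq_iff_eq_neg] at this
    rw [← this, Int.negOnePow_sub, Int.negOnePow_one]
    simp

theorem classK0_biprod (X Y : D) : classK0 (X ⊞ Y) = classK0 X + classK0 Y :=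
  classK0_obj₂ (binaryBiproductTriangle_distinguished X Y)

theorem classK0_biproduct {J : Type} [Fintype J] (F : J → D) :
    classK0 (⨁ F) = ∑ j, classK0 (F j) := by
  refine Fintype.induction_empty_option (P := fun J _ => ∀ F : J → D,
    classK0 (⨁ F) = ∑ j, classK0 (F j)) ?_ ?_ ?_ J F
  · intro α β _ e h F
    let _ := Fintype.ofEquiv β e.symm
    rw [← classK0_eq_of_iso (biproduct.reindex e F), h]
    exact Fintype.sum_equiv e _ _ fun _ => rfl
  · intro F
    rw [classK0_of_isZero]
    · simp
    · rw [IsZero.iff_id_eq_zero]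
      exact biproduct.hom_ext _ _ fun j => j.elim
  · intro α _ h F
    rw [classK0_eq_of_iso (biproductOptionIso F), classK0_biprod, h, Fintype.sum_option]

/-- The homomorphism out of the Grothendieck group defined by an additive function. -/
def liftK0 {A : Type*} [AddCommGroup A] (f : D → A)
    (hf : ∀ T ∈ distTriang D, f T.obj₁ - f T.obj₂ + f T.obj₃ = 0) : TriangulatedK0 D →+ A :=
  QuotientAddGroup.lift _ (FreeAbelianGroup.lift f) <| (AddSubgroup.closure_le _).2 <| by
    rintro _ ⟨T, hT, rfl⟩
    simpa using hf T hT

@[simp]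
theorem liftK0_classK0 {A : Type*} [AddCommGroup A] (f : D → A)
    (hf : ∀ T ∈ distTriang D, f T.obj₁ - f T.obj₂ + f T.obj₃ = 0) (X : D) :
    liftK0 f hf (classK0 X) = f X :=
  FreeAbelianGroup.lift_apply_of f X

theorem K0_induction {P : TriangulatedK0 D → Prop} (x : TriangulatedK0 D)
    (h : ∀ X : D, P (classK0 X)) (h0 : P 0) (hneg : ∀ x, P x → P (-x))
    (hadd : ∀ x y, P x → P y → P (x + y)) : P x := by
  obtain ⟨x, rfl⟩ := QuotientAddGroup.mk_surjective x
  exact FreeAbelianGroup.induction_on x h0 h (fun X hX => hneg _ hX) fun x y hx hy => hadd _ _ hx hy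

theorem K0_addHom_ext {A : Type*} [AddCommGroup A] {f g : TriangulatedK0 D →+ A}
    (h : ∀ X : D, f (classK0 X) = g (classK0 X)) : f = g := by
  ext x
  exact K0_induction (P := fun x => f x = g x) x h (by simp) (fun x hx => by simp [hx])
    fun x y hx hy => by simp [hx, hy]

/-- Objects with class in a given subgroup form a triangulated subcategory, so fullness applies. -/
theorem span_classK0_eq_top {n : ℕ} {E : Fin n → D} (hE : IsFullExceptionalCollection k E) :
    Submodule.span ℤ (Set.range fun i => classK0 (E i)) = ⊤ := by
  set S := Submodule.span ℤ (Set.range fun i => classK0 (E i))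
  let P : ObjectProperty D := fun X => classK0 X ∈ S
  have hiso : P.IsClosedUnderIsomorphisms := ⟨fun e hX => by
    simpa only [P, classK0_eq_of_iso e] using hX⟩
  have htri : P.IsTriangulated :=
    { exists_zero := ⟨0, isZero_zero D, by simp [P, classK0_of_isZero (isZero_zero D)]⟩
      isStableUnderShiftBy := fun a => ⟨fun X hX => by
        change classK0 (X⟦a⟧) ∈ S
        rw [classK0_shift]
        exact S.smul_mem _ hX⟩
      ext₂' := fun T hT h1 h3 => ObjectProperty.le_isoClosure _ _ (by
        change classK0 T.obj₂ ∈ S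
        rw [classK0_obj₂ hT]
        exact S.add_mem h1 h3) }
  have hall := hE.full P htri hiso fun i => Submodule.subset_span ⟨i, rfl⟩
  exact eq_top_iff.2 fun x _ => K0_induction x hall S.zero_mem (fun x => S.neg_mem)
    fun x y => S.add_mem

/-! ### Construction of the Euler form -/

section EulerForm

variable [IsOfFiniteType k D]

/-- Postcomposition with an isomorphism, as a linear equivalence. -/
def homCongrRight (X : D) {Y Y' : D} (e : Y ≅ Y') : (X ⟶ Y) ≃ₗ[k] (X ⟶ Y') :=
  { Linear.rightComp k X e.hom with
    invFun := fun f => f ≫ e.inv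
    left_inv := fun f => by simp
    right_inv := fun f => by simp }

theorem homCongrRight_apply (X : D) {Y Y' : D} (e : Y ≅ Y') (f : X ⟶ Y) :
    homCongrRight k X e f = f ≫ e.hom := rfl

theorem finite_hom (X Y : D) : Module.Finite k (X ⟶ Y) :=
  Module.Finite.equiv (homCongrRight k X ((shiftFunctorZero D ℤ).app Y))

theorem finite_support_finrank_hom_shift (X Y : D) :
    (Function.support fun p : ℤ => Module.finrank k (X ⟶ Y⟦p⟧)).Finite :=
  (Set.finite_range (Sigma.fst : HomIndex k X Y → ℤ)).subset fun p hp =>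
    ⟨⟨p, 0, Nat.pos_of_ne_zero hp⟩, rfl⟩

/-- The shifted triangle carries signs `(-1)^p` on its morphisms; they are absorbed into `ψ`. -/
theorem exists_lift_shift {T : Triangle D} (hT : T ∈ distTriang D) (p : ℤ) {X : D}
    (φ : X ⟶ T.obj₂⟦p⟧) (hφ : φ ≫ T.mor₂⟦p⟧' = 0) : ∃ ψ : X ⟶ T.obj₁⟦p⟧, φ = ψ ≫ T.mor₁⟦p⟧' := by
  obtain ⟨ψ, hψ⟩ : ∃ ψ : X ⟶ T.obj₁⟦p⟧, φ = ψ ≫ (p.negOnePow • T.mor₁⟦p⟧') :=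
    Triangle.coyoneda_exact₂ _ (Triangle.shift_distinguished T hT p) φ (by
      change φ ≫ (p.negOnePow • T.mor₂⟦p⟧') = 0
      rw [Linear.comp_units_smul, hφ, smul_zero])
  refine ⟨p.negOnePow • ψ, hψ.trans ?_⟩
  rw [Linear.comp_units_smul, Linear.units_smul_comp]

/-- The dimension of the kernel of `Hom(X, T₁[p]) → Hom(X, T₂[p])`. -/
def kerRankLeft (X : D) (T : Triangle D) (p : ℤ) : ℕ :=
  Module.finrank k (LinearMap.ker (Linear.rightComp k X (T.mor₁⟦p⟧')))

theorem finrank_hom_obj₁ (X : D) {T : Triangle D} (hT : T ∈ distTriang D) (p : ℤ) :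
    Module.finrank k (X ⟶ T.obj₁⟦p⟧) = kerRankLeft k X T p + kerRankLeft k X T.rotate p := by
  refine finrank_eq_add_of_exact _ (Linear.rightComp k X (T.mor₂⟦p⟧')) ?_
  ext φ
  constructor
  · rintro ⟨ψ, rfl⟩
    simp [← Functor.map_comp, comp_distTriang_mor_zero₁₂ T hT]
  · intro h
    obtain ⟨ψ, hψ⟩ := exists_lift_shift hT p φ h
    exact ⟨ψ, hψ.symm⟩

/-- Three rotations give the translated triangle up to signs, which do not affect kernels. This
closes the long exact sequence on itself with `p` replaced by `p + 1`. -/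
theorem kerRankLeft_rotate_rotate_rotate (X : D) (T : Triangle D) (p : ℤ) :
    kerRankLeft k X T.rotate.rotate.rotate p = kerRankLeft k X T (p + 1) := by
  refine finrank_ker_eq_of_equiv (Linear.rightComp k X ((-T.mor₁⟦(1 : ℤ)⟧')⟦p⟧')) _
    (homCongrRight k X
      ((shiftFunctorAdd' D 1 p (p + 1) (add_comm _ _)).symm.app T.obj₁)) fun φ => ?_
  have h := (shiftFunctorAdd' D 1 p (p + 1) (add_comm _ _)).inv.naturality T.mor₁
  simp only [Functor.comp_map] at h
  simp only [Linear.rightComp_apply, homCongrRight_apply, Iso.app_hom, Iso.symm_hom,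
    Functor.map_neg, Preadditive.comp_neg, neg_eq_zero, Category.assoc]
  rw [← h, ← Category.assoc]
  exact (Preadditive.IsIso.comp_right_eq_zero _ _).symm

theorem altSum_left {T : Triangle D} (hT : T ∈ distTriang D) (X : D) :
    altSum (fun p => Module.finrank k (X ⟶ T.obj₁⟦p⟧)) -
      altSum (fun p => Module.finrank k (X ⟶ T.obj₂⟦p⟧)) +
      altSum (fun p => Module.finrank k (X ⟶ T.obj₃⟦p⟧)) = 0 := by
  refine altSum_eq_zero_of_exact (κ := kerRankLeft k X T) (finite_support_finrank_hom_shift k _ _)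
    (finite_support_finrank_hom_shift k _ _) (finite_support_finrank_hom_shift k _ _)
    ((finite_support_finrank_hom_shift k X T.obj₁).subset fun p hp => ?_) fun p => ?_
  · have := finrank_hom_obj₁ k X hT p
    simp only [Function.mem_support] at hp ⊢
    omega
  · have h1 := finrank_hom_obj₁ k X hT p
    have h2 : Module.finrank k (X ⟶ T.obj₂⟦p⟧) = _ :=
      finrank_hom_obj₁ k X (rot_of_distTriang _ hT) p
    have h3 : Module.finrank k (X ⟶ T.obj₃⟦p⟧) = _ :=
      finrank_hom_obj₁ k X (rot_of_distTriang _ (rot_of_distTriang _ hT)) p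
    rw [kerRankLeft_rotate_rotate_rotate] at h3
    omega

/-- The dimension of the kernel of `Hom(T₃, Y[p]) → Hom(T₂, Y[p])`. -/
def kerRankRight (Y : D) (T : Triangle D) (p : ℤ) : ℕ :=
  Module.finrank k (LinearMap.ker (Linear.leftComp k (Y⟦p⟧) T.mor₂))

/-- Stated for `T₁[1]` because this is where `T.mor₃` lands; `homShiftEquiv` later removes the
shift. -/
theorem finrank_hom_obj₁_shift_one (Y : D) {T : Triangle D} (hT : T ∈ distTriang D) (p : ℤ) :
    Module.finrank k (T.obj₁⟦(1 : ℤ)⟧ ⟶ Y⟦p⟧) =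
      kerRankRight k Y T.rotate p + kerRankRight k Y T p := by
  refine finrank_eq_add_of_exact (Linear.leftComp k (Y⟦p⟧) T.mor₃) (Linear.leftComp k (Y⟦p⟧) T.mor₂) ?_
  ext φ
  constructor
  · rintro ⟨ψ, rfl⟩
    change T.mor₂ ≫ T.mor₃ ≫ ψ = 0
    rw [comp_distTriang_mor_zero₂₃_assoc T hT, zero_comp]
  · intro h
    obtain ⟨ψ, hψ⟩ := Triangle.yoneda_exact₃ T hT φ h
    exact ⟨ψ, hψ.symm⟩

variable [∀ n : ℤ, (shiftFunctor D n).Linear k]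

/-- `Hom(X, Y[r]) ≅ Hom(X[p], Y[r + p])`. -/
def homShiftEquiv (X Y : D) {r p q : ℤ} (h : r + p = q) : (X ⟶ Y⟦r⟧) ≃ₗ[k] (X⟦p⟧ ⟶ Y⟦q⟧) :=
  (LinearEquiv.ofBijective ((shiftFunctor D p).mapLinearMap k)
    ⟨(shiftFunctor D p).map_injective, (shiftFunctor D p).map_surjective⟩).trans
    (homCongrRight k _ ((shiftFunctorAdd' D r p q h).symm.app Y))

theorem homShiftEquiv_apply (X Y : D) {r p q : ℤ} (h : r + p = q) (φ : X ⟶ Y⟦r⟧) :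
    homShiftEquiv k X Y h φ = φ⟦p⟧' ≫ (shiftFunctorAdd' D r p q h).inv.app Y :=
  rfl

theorem homShiftEquiv_comp {X' X : D} (f : X' ⟶ X) (Y : D) {r p q : ℤ} (h : r + p = q)
    (φ : X ⟶ Y⟦r⟧) : homShiftEquiv k X' Y h (f ≫ φ) = f⟦p⟧' ≫ homShiftEquiv k X Y h φ := by
  simp [homShiftEquiv_apply]

theorem kerRankRight_rotate_rotate_rotate (Y : D) (T : Triangle D) (p : ℤ) :
    kerRankRight k Y T.rotate.rotate.rotate (p + 1) = kerRankRight k Y T p := by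
  refine (finrank_ker_eq_of_equiv _ _ (homShiftEquiv k T.obj₃ Y (Eq.refl (p + 1))) fun φ => ?_).symm
  change T.mor₂ ≫ φ = 0 ↔ (-T.mor₂⟦(1 : ℤ)⟧') ≫ homShiftEquiv k T.obj₃ Y (Eq.refl (p + 1)) φ = 0
  rw [Preadditive.neg_comp, neg_eq_zero, ← homShiftEquiv_comp, LinearEquiv.map_eq_zero_iff]

theorem altSum_right {T : Triangle D} (hT : T ∈ distTriang D) (Y : D) :
    altSum (fun p => Module.finrank k (T.obj₁ ⟶ Y⟦p⟧)) -
      altSum (fun p => Module.finrank k (T.obj₂ ⟶ Y⟦p⟧)) +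
      altSum (fun p => Module.finrank k (T.obj₃ ⟶ Y⟦p⟧)) = 0 := by
  have key : ∀ p, Module.finrank k (T.obj₁ ⟶ Y⟦p⟧) + Module.finrank k (T.obj₃ ⟶ Y⟦p⟧) =
      Module.finrank k (T.obj₂ ⟶ Y⟦p⟧) + (kerRankRight k Y T p + kerRankRight k Y T (p + 1)) := by
    intro p
    have hT' := rot_of_distTriang _ hT
    -- Degree `p + 1` compensates the shift on the source: `Hom(T_i[1], Y[p + 1]) ≅ Hom(T_i, Y[p])`.
    have h1 := finrank_hom_obj₁_shift_one k Y hT (p + 1)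
    have h2 : Module.finrank k (T.obj₂⟦(1 : ℤ)⟧ ⟶ Y⟦p + 1⟧) = _ :=
      finrank_hom_obj₁_shift_one k Y hT' (p + 1)
    have h3 : Module.finrank k (T.obj₃⟦(1 : ℤ)⟧ ⟶ Y⟦p + 1⟧) = _ :=
      finrank_hom_obj₁_shift_one k Y (rot_of_distTriang _ hT') (p + 1)
    rw [kerRankRight_rotate_rotate_rotate] at h3
    rw [← (homShiftEquiv k _ Y (Eq.refl (p + 1))).finrank_eq] at h1 h2 h3
    omega
  refine altSum_eq_zero_of_exact (κ := kerRankRight k Y T) (finite_support_finrank_hom_shift k _ _)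
    (finite_support_finrank_hom_shift k _ _) (finite_support_finrank_hom_shift k _ _)
    ((finite_support_finrank_hom_shift k T.obj₃ Y).subset fun p hp => ?_) key
  intro h
  have : Module.finrank k (LinearMap.ker (Linear.leftComp k (Y⟦p⟧) T.mor₂)) ≤
    Module.finrank k (T.obj₃ ⟶ Y⟦p⟧) := Submodule.finrank_le _
  exact hp (Nat.le_zero.1 (this.trans_eq h))

/-- The pairing `[X], [Y] ↦ ∑ (-1)^p dim Hom(X, Y[p])` for a fixed object `X`. -/
def eulerHom (X : D) : TriangulatedK0 D →+ ℤ :=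
  liftK0 (fun Y => altSum fun p => Module.finrank k (X ⟶ Y⟦p⟧)) fun _ hT => altSum_left k hT X

variable (D) in
/-- The Euler form as a biadditive map. -/
def eulerAddHom : TriangulatedK0 D →+ TriangulatedK0 D →+ ℤ :=
  -- Additivity in the first variable is an identity of homomorphisms on K₀, so it may be tested on
  -- classes of objects.
  liftK0 (eulerHom k) fun T hT => K0_addHom_ext fun Y => by
    simpa [eulerHom] using altSum_right k hT Y

variable (D) in
/-- The Euler form. -/
def eulerForm : LinearMap.BilinForm ℤ (TriangulatedK0 D) :=
  ((addMonoidHomLequivInt ℤ).toLinearMap.toAddMonoidHom.comp (eulerAddHom k D)).toIntLinearMap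

theorem isEulerForm_eulerForm : IsEulerForm k D (eulerForm k D) := by
  intro X Y
  change eulerAddHom k D (classK0 X) (classK0 Y) = _
  rw [eulerAddHom, liftK0_classK0]
  exact liftK0_classK0 _ _ Y

end EulerForm

end GrothendieckGroup

/-! ### Representing functors on an exceptional family -/

section Representability

universe t

variable (k : Type w) [Field k] (C : Type u) [Category.{v} C] [Preadditive C] [Linear k C]

/-- A `k`-linear contravariant functor from `C` to vector spaces. -/
structure ContraModule where
  obj : C → Type t
  [addCommGroup : ∀ x, AddCommGroup (obj x)]
  [module : ∀ x, Module k (obj x)]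
  map : ∀ {x y : C}, (x ⟶ y) →ₗ[k] obj y →ₗ[k] obj x
  map_id : ∀ (x : C) (u : obj x), map (𝟙 x) u = u
  map_comp : ∀ {x y z : C} (f : x ⟶ y) (g : y ⟶ z) (u : obj z), map (f ≫ g) u = map f (map g u)

attribute [instance] ContraModule.addCommGroup ContraModule.module

variable {C}

/-- The functor `Hom(-, b)`. -/
def ContraModule.hom (b : C) : ContraModule.{w, v, u, v} k C where
  obj x := x ⟶ b
  map {x y} := Linear.comp x y b
  map_id _ := Category.id_comp
  map_comp := Category.assoc

/-- The functor `Hom(a, -)^*`. -/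
def ContraModule.dual (a : C) : ContraModule.{w, v, u, max v w} k C where
  obj x := Module.Dual k (a ⟶ x)
  map {x y} :=
    { toFun := fun f => (Linear.rightComp k a f).dualMap
      map_add' := fun f g => by ext u h; simp
      map_smul' := fun c f => by ext u h; simp }
  map_id x u := by ext h; simp
  map_comp f g u := by ext h; simp

variable {k}

namespace ContraModule

/-- The map `Hom(x, r) → M(x)` given by an element of `M(r)`. -/
def eval (M : ContraModule.{w, v, u, t} k C) {r : C} (u : M.obj r) (x : C) :
    (x ⟶ r) →ₗ[k] M.obj x := M.map.flip u

theorem eval_apply (M : ContraModule.{w, v, u, t} k C) {r : C} (u : M.obj r) {x : C} (f : x ⟶ r) :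
    M.eval u x f = M.map f u := rfl

variable [HasFiniteBiproducts C] {P : Type}

/-- For a family of pairwise orthogonal objects with one-dimensional endomorphism spaces, a functor
with finite total dimension on the family is represented, on this family, by a finite sum of
members of the family. -/
theorem exists_biproduct_represents (M : ContraModule.{w, v, u, t} k C) (e : P → C)
    (hend : ∀ p (f : e p ⟶ e p), ∃ c : k, f = c • 𝟙 (e p))
    (hne : ∀ p q, p ≠ q → ∀ f : e p ⟶ e q, f = 0)
    [∀ p, Module.Finite k (M.obj (e p))]
    [Finite (Σ p, Fin (Module.finrank k (M.obj (e p))))] :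
    ∃ (J : Type) (_ : Finite J) (d : J → P) (u : M.obj (⨁ fun j => e (d j))),
      ∀ p, Function.Bijective (M.eval u (e p)) := by
  classical
  let J := Σ p, Fin (Module.finrank k (M.obj (e p)))
  let _ : Fintype J := Fintype.ofFinite J
  let b : ∀ j : J, M.obj (e j.1) := fun j => Module.finBasis k (M.obj (e j.1)) j.2
  let F : J → C := fun j => e j.1
  -- The universal element: one summand per vector of a homogeneous basis. A morphism from `e p`
  -- with components `c i • 𝟙` is sent to `∑ c i • b i`.
  let u : M.obj (⨁ F) := ∑ j, M.map (biproduct.π F j) (b j)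
  have heval : ∀ {x : C} (f : x ⟶ ⨁ F), M.eval u x f = ∑ j, M.map (f ≫ biproduct.π F j) (b j) :=
    fun f => by simp only [eval_apply, u, map_sum, M.map_comp]
  refine ⟨J, inferInstance, Sigma.fst, u, fun p => ⟨?_, ?_⟩⟩
  · rw [injective_iff_map_eq_zero]
    intro f hf
    choose c hc using fun i => hend p (f ≫ biproduct.π F ⟨p, i⟩)
    have hsum : M.eval u (e p) f = ∑ i, c i • Module.finBasis k (M.obj (e p)) i := by
      rw [heval]
      refine (Fintype.sum_of_injective (Sigma.mk p) sigma_mk_injective _ _ ?_ fun i => ?_).symm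
      · rintro ⟨q, i⟩ hq
        have : p ≠ q := by
          rintro rfl
          exact hq ⟨i, rfl⟩
        rw [hne p q this (f ≫ biproduct.π F ⟨q, i⟩)]
        simp
      · rw [hc i]
        simp [M.map_id, b]
    rw [hsum] at hf
    have hc0 := Fintype.linearIndependent_iff.1 (Module.finBasis k (M.obj (e p))).linearIndependent
      c hf
    refine biproduct.hom_ext _ _ ?_
    rintro ⟨q, i⟩
    rw [zero_comp]
    by_cases hq : p = q
    · subst hq
      rw [hc i, hc0 i, zero_smul]
    · exact hne p q hq _
  · intro y
    refine ⟨∑ i, (Module.finBasis k (M.obj (e p))).repr y i • biproduct.ι F ⟨p, i⟩, ?_⟩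
    have hι : ∀ j : J, M.eval u (F j) (biproduct.ι F j) = b j := fun j => by
      rw [heval, Finset.sum_eq_single j]
      · simp [M.map_id]
      · intro j' _ hj
        rw [biproduct.ι_π_ne _ hj.symm]
        simp
      · simp
    rw [map_sum]
    simp only [map_smul]
    conv_rhs => rw [← (Module.finBasis k (M.obj (e p))).sum_repr y]
    exact Finset.sum_congr rfl fun i _ => congrArg _ (hι ⟨p, i⟩)

theorem eq_zero_of_biproduct (M : ContraModule.{w, v, u, t} k C) {J : Type} [Finite J] (F : J → C)
    (u : M.obj (⨁ F)) (h : ∀ j, M.map (biproduct.ι F j) u = 0) : u = 0 := by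
  let _ := Fintype.ofFinite J
  rw [← M.map_id _ u, ← biproduct.total, map_sum, LinearMap.sum_apply]
  exact Finset.sum_eq_zero fun j _ => by rw [M.map_comp, h, map_zero]

end ContraModule

variable (k)

/-- A family of objects `e i p`, to be thought of as the translates `E_i[p]` of the members of an
exceptional collection, in a category with a class of composable morphisms, to be thought of as
those that belong to distinguished triangles. -/
structure IsExceptionalFamily {P : Type} {n : ℕ} (tri : ∀ {a m r : C}, (a ⟶ m) → (m ⟶ r) → Prop)
    (e : Fin n → P → C) : Prop where
  cone : ∀ {a m : C} (f : a ⟶ m), ∃ (r : C) (g : m ⟶ r), tri f g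
  comp_eq_zero : ∀ {a m r : C} {f : a ⟶ m} {g : m ⟶ r}, tri f g → f ≫ g = 0
  exact_left : ∀ {a m r : C} {f : a ⟶ m} {g : m ⟶ r}, tri f g →
    ∀ {x : C} (φ : x ⟶ m), φ ≫ g = 0 → ∃ ψ, φ = ψ ≫ f
  exact_right : ∀ {a m r : C} {f : a ⟶ m} {g : m ⟶ r}, tri f g →
    ∀ {x : C} (φ : m ⟶ x), f ≫ φ = 0 → ∃ ψ, φ = g ≫ ψ
  exists_lift : ∀ {a m r : C} {f : a ⟶ m} {g : m ⟶ r}, tri f g → ∀ i,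
    (∀ p (ψ : e i p ⟶ a), ψ ≫ f = 0 → ψ = 0) → ∀ p (φ : e i p ⟶ r), ∃ ψ, φ = ψ ≫ g
  end_eq : ∀ i p (f : e i p ⟶ e i p), ∃ c : k, f = c • 𝟙 _
  eq_zero_of_ne : ∀ i p q, p ≠ q → ∀ f : e i p ⟶ e i q, f = 0
  eq_zero_of_lt : ∀ i j, j < i → ∀ p q (f : e i p ⟶ e j q), f = 0
  finite_hom : ∀ x y : C, Module.Finite k (x ⟶ y)
  finite_from : ∀ i x, Finite (Σ p, Fin (Module.finrank k (e i p ⟶ x)))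
  finite_to : ∀ i x, Finite (Σ p, Fin (Module.finrank k (x ⟶ e i p)))

namespace IsExceptionalFamily

variable {k} {P : Type} {n : ℕ}
  {tri : ∀ {a m r : C}, (a ⟶ m) → (m ⟶ r) → Prop}
  {e : Fin n → P → C} (he : IsExceptionalFamily k tri e)
include he

/-- The range of a dual map is the annihilator of the kernel, so `Hom(a, -)^*` inherits
half-exactness from `Hom(a, -)`. -/
theorem exact_dual (a : C) {x m r : C} {f : x ⟶ m} {g : m ⟶ r} (hg : tri f g)
    (u : Module.Dual k (a ⟶ m)) (hu : (ContraModule.dual k a).map f u = 0) :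
    ∃ z : Module.Dual k (a ⟶ r), (ContraModule.dual k a).map g z = u := by
  have : u ∈ LinearMap.range (Linear.rightComp k a g).dualMap := by
    rw [LinearMap.range_dualMap_eq_dualAnnihilator_ker, Submodule.mem_dualAnnihilator]
    intro φ hφ
    obtain ⟨ψ, rfl⟩ := he.exact_left hg φ hφ
    exact LinearMap.congr_fun hu ψ
  exact this

variable [HasFiniteBiproducts C] [HasBinaryBiproducts C]

/-- If an element represents `M` on the `e j p` with `j > i`, it can be modified so that it
represents `M` on the `e j p` with `j ≥ i`. -/
theorem extend_represents (M : ContraModule.{w, v, u, t} k C)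
    (hM : ∀ {a m r : C} {f : a ⟶ m} {g : m ⟶ r}, tri f g → ∀ u, M.map f u = 0 → ∃ z, M.map g z = u)
    (i : Fin n) [∀ p, Module.Finite k (M.obj (e i p))]
    [Finite (Σ p, Fin (Module.finrank k (M.obj (e i p))))] {b : C} (u : M.obj b)
    (hu : ∀ j, i < j → ∀ p, Function.Bijective (M.eval u (e j p))) :
    ∃ (r : C) (z : M.obj r), ∀ j, i ≤ j → ∀ p, Function.Bijective (M.eval z (e j p)) := by
  have hvanish : ∀ {L : Type} [Finite L] (q : L → P) {x : C},
      (∀ p (f : x ⟶ e i p), f = 0) → ∀ f : x ⟶ ⨁ fun l => e i (q l), f = 0 := fun q x h f =>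
    biproduct.hom_ext _ _ fun l => (h _ _).trans zero_comp.symm
  -- Here `a` is a sum of members `e i p` representing `M` on them. Below, `s : a' ⟶ b` does the
  -- same for `Hom(-, b)`. The new object is the cone of `(s, t) : a' ⟶ b ⊞ a`, which on the `e i p`
  -- trades the contribution of `b` for that of `a`.
  obtain ⟨a, y, hy, ha⟩ : ∃ (a : C) (y : M.obj a), (∀ p, Function.Bijective (M.eval y (e i p))) ∧
      ∀ {x : C}, (∀ p (f : x ⟶ e i p), f = 0) → ∀ f : x ⟶ a, f = 0 := by
    obtain ⟨J, _, d, y, hy⟩ :=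
      M.exists_biproduct_represents (e i) (he.end_eq i) (he.eq_zero_of_ne i)
    exact ⟨_, y, hy, hvanish d⟩
  obtain ⟨a', s, hs, ha', hlift'⟩ : ∃ (a' : C) (s : a' ⟶ b),
      (∀ p, Function.Bijective fun φ : e i p ⟶ a' => φ ≫ s) ∧
      (∀ {x : C}, (∀ p (f : x ⟶ e i p), f = 0) → ∀ f : x ⟶ a', f = 0) ∧
      ∀ w : M.obj a', ∃ t : a' ⟶ a, M.map t y = w := by
    have : ∀ p, Module.Finite k ((ContraModule.hom k b).obj (e i p)) := fun p =>
      he.finite_hom (e i p) b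
    have : Finite (Σ p, Fin (Module.finrank k ((ContraModule.hom k b).obj (e i p)))) :=
      he.finite_from i b
    obtain ⟨J, _, d, s, hs⟩ := (ContraModule.hom k b).exists_biproduct_represents (e i)
      (he.end_eq i) (he.eq_zero_of_ne i)
    refine ⟨_, s, hs, hvanish d, fun w => ?_⟩
    choose t ht using fun j => (hy (d j)).2 (M.map (biproduct.ι (fun j => e i (d j)) j) w)
    refine ⟨biproduct.desc t, ?_⟩
    rw [← sub_eq_zero]
    refine M.eq_zero_of_biproduct _ _ fun j => ?_
    rw [map_sub, ← M.map_comp, biproduct.ι_desc, sub_eq_zero]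
    exact ht j
  obtain ⟨t, ht⟩ := hlift' (M.map s u)
  obtain ⟨r, g, hg⟩ := he.cone (biprod.lift s t)
  -- The difference of `u` and `y` dies on `a'` by the choice of `t`, hence extends to the cone.
  obtain ⟨z, hz⟩ := hM hg (M.map biprod.fst u - M.map biprod.snd y) (by
    rw [map_sub, ← M.map_comp, ← M.map_comp, biprod.lift_fst, biprod.lift_snd, ht, sub_self])
  have hval : ∀ {x : C} (ψ : x ⟶ b ⊞ a), M.eval z x (ψ ≫ g) =
      M.eval u x (ψ ≫ biprod.fst) - M.eval y x (ψ ≫ biprod.snd) := fun ψ => by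
    simp only [ContraModule.eval_apply, M.map_comp, hz, map_sub]
  refine ⟨r, z, fun j hj => ?_⟩
  rcases hj.lt_or_eq with hj | rfl
  -- For `j > i` there are no morphisms to `a` or `a'`, so the cone looks like `b`.
  · have h0 : ∀ p q (f : e j p ⟶ e i q), f = 0 := he.eq_zero_of_lt j i hj
    have hlift := he.exists_lift hg j fun p ψ _ => ha' (h0 p) ψ
    refine fun p => ⟨?_, fun x => ?_⟩
    · rw [injective_iff_map_eq_zero]
      intro φ hφ
      obtain ⟨ψ, rfl⟩ := hlift p φ
      have h2 : ψ ≫ biprod.snd = 0 := ha (h0 p) _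
      rw [hval, h2, map_zero, sub_zero] at hφ
      have h1 := (injective_iff_map_eq_zero _).1 (hu j hj p).1 _ hφ
      rw [show ψ = 0 from biprod.hom_ext _ _ (by rw [h1, zero_comp]) (by rw [h2, zero_comp]),
        zero_comp]
    · obtain ⟨ψ, hψ⟩ := (hu j hj p).2 x
      refine ⟨(ψ ≫ biprod.inl) ≫ g, ?_⟩
      rw [hval]
      simpa using hψ
  · have hinj : ∀ p (ψ : e i p ⟶ a'), ψ ≫ s = 0 → ψ = 0 := fun p ψ hψ =>
      (hs p).1 (hψ.trans zero_comp.symm)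
    have hlift := he.exists_lift hg i fun p ψ hψ => hinj p ψ (by
      simpa using congrArg (· ≫ biprod.fst) hψ)
    refine fun p => ⟨?_, fun x => ?_⟩
    · rw [injective_iff_map_eq_zero]
      intro φ hφ
      obtain ⟨ψ, rfl⟩ := hlift p φ
      -- Subtracting a morphism through `a'` kills the `b`-component of `ψ` without changing `ψ ≫
      -- g`.
      obtain ⟨χ, hχ⟩ : ∃ χ : e i p ⟶ a', χ ≫ s = ψ ≫ biprod.fst := (hs p).2 (ψ ≫ biprod.fst)
      have hψ : (ψ - χ ≫ biprod.lift s t) ≫ g = ψ ≫ g := by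
        rw [Preadditive.sub_comp, Category.assoc, he.comp_eq_zero hg, comp_zero, sub_zero]
      have h1 : (ψ - χ ≫ biprod.lift s t) ≫ biprod.fst = 0 := by simp [hχ]
      rw [← hψ, hval, h1, map_zero, zero_sub, neg_eq_zero] at hφ
      have h2 := (injective_iff_map_eq_zero _).1 (hy p).1 _ hφ
      rw [← hψ, show ψ - χ ≫ biprod.lift s t = 0 from
        biprod.hom_ext _ _ (by rw [h1, zero_comp]) (by rw [h2, zero_comp]), zero_comp]
    · obtain ⟨ψ, hψ⟩ := (hy p).2 (-x)
      refine ⟨(ψ ≫ biprod.inr) ≫ g, ?_⟩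
      rw [hval]
      simpa using congrArg Neg.neg hψ

theorem exists_represents (M : ContraModule.{w, v, u, t} k C)
    (hM : ∀ {a m r : C} {f : a ⟶ m} {g : m ⟶ r}, tri f g → ∀ u, M.map f u = 0 → ∃ z, M.map g z = u)
    [∀ i p, Module.Finite k (M.obj (e i p))]
    [∀ i, Finite (Σ p, Fin (Module.finrank k (M.obj (e i p))))] :
    ∃ (r : C) (z : M.obj r), ∀ j p, Function.Bijective (M.eval z (e j p)) := by
  -- Descending induction through the collection: `m` counts the last members already handled,
  -- starting from a zero object.
  suffices h : ∀ m ≤ n, ∃ (r : C) (z : M.obj r), ∀ j : Fin n, n ≤ j + m →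
      ∀ p, Function.Bijective (M.eval z (e j p)) by
    obtain ⟨r, z, hz⟩ := h n le_rfl
    exact ⟨r, z, fun j => hz j (Nat.le_add_left _ _)⟩
  intro m
  induction m with
  | zero => exact fun _ => ⟨⨁ fun x : Empty => x.elim, 0, fun j hj => by have := j.isLt; omega⟩
  | succ m ih =>
    intro hm
    obtain ⟨b, u, hu⟩ := ih (by omega)
    obtain ⟨r, z, hz⟩ := he.extend_represents M hM ⟨n - (m + 1), by omega⟩ u fun j hj =>
      hu j (by rw [Fin.lt_def] at hj; dsimp only at hj; omega)
    exact ⟨r, z, fun j hj => hz j (by rw [Fin.le_def]; dsimp only; omega)⟩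

/-- There are an object `r` and a form on `Hom(a, r)` such that the pairings
`Hom(a, e i p) × Hom(e i p, r) → k` are perfect. -/
theorem exists_dual_represents (a : C) : ∃ (r : C) (z : Module.Dual k (a ⟶ r)),
    ∀ i p, Function.Bijective ((ContraModule.dual k a).eval z (e i p)) := by
  have h1 : ∀ i p, Module.Finite k ((ContraModule.dual k a).obj (e i p)) := fun i p => by
    have := he.finite_hom a (e i p)
    exact inferInstanceAs (Module.Finite k (Module.Dual k (a ⟶ e i p)))
  have h2 : ∀ i, Finite (Σ p, Fin (Module.finrank k ((ContraModule.dual k a).obj (e i p)))) :=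
    fun i => by
      have := he.finite_to i a
      refine Finite.of_equiv (Σ p, Fin (Module.finrank k (a ⟶ e i p))) (Equiv.sigmaCongrRight fun p => finCongr ?_)
      exact (Subspace.dual_finrank_eq (K := k) (V := a ⟶ e i p)).symm
  exact he.exists_represents (ContraModule.dual k a) (fun hg u hu => he.exact_dual a hg u hu)

end IsExceptionalFamily

end Representability

/-! ### The linear structure on the opposite category -/

section Opposite

variable (k : Type w) [Field k] {C : Type u} [Category.{v} C] [Preadditive C] [Linear k C]

/-- The `k`-linear structure on the opposite of a `k`-linear category. -/
instance linearOpposite : Linear k Cᵒᵖ where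
  homModule X Y := (opEquiv X Y).module k
  smul_comp _ _ _ c f g := Quiver.Hom.unop_inj (Linear.comp_smul (R := k) _ _ _ g.unop c f.unop)
  comp_smul _ _ _ f c g := Quiver.Hom.unop_inj (Linear.smul_comp (R := k) _ _ _ c g.unop f.unop)

/-- Morphisms in the opposite category, as a linear equivalence. -/
def opLinearEquiv (X Y : C) : (Opposite.op Y ⟶ Opposite.op X) ≃ₗ[k] (X ⟶ Y) where
  toFun f := f.unop
  invFun f := f.op
  map_add' _ _ := rfl
  map_smul' _ _ := rfl

end Opposite

/-! ### Dual objects from a full exceptional collection -/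

section SerreDuality

variable (k : Type w) [Field k] {D : Type u} [Category.{v} D] [Preadditive D] [HasZeroObject D]
  [HasShift D ℤ] [∀ n : ℤ, (shiftFunctor D n).Additive] [Pretriangulated D] [Linear k D]

/-- Two composable morphisms which are part of a distinguished triangle. -/
def InDistTriang {a m r : D} (f : a ⟶ m) (g : m ⟶ r) : Prop :=
  ∃ h : r ⟶ a⟦(1 : ℤ)⟧, Triangle.mk f g h ∈ distTriang D

/-- Two composable morphisms of the opposite category which come from a distinguished triangle. -/
def OpInDistTriang {a m r : Dᵒᵖ} (f : a ⟶ m) (g : m ⟶ r) : Prop :=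
  InDistTriang g.unop f.unop

variable [∀ n : ℤ, (shiftFunctor D n).Linear k] [IsOfFiniteType k D]

instance finite_homIndex_shift_left (X Y : D) :
    Finite (Σ p : ℤ, Fin (Module.finrank k (X⟦p⟧ ⟶ Y))) := by
  refine Finite.of_equiv (HomIndex k X Y) (Equiv.sigmaCongr (Equiv.neg ℤ) fun p => finCongr ?_)
  exact ((homShiftEquiv k X Y (add_neg_cancel p)).trans
    (homCongrRight k _ ((shiftFunctorZero D ℤ).app Y))).finrank_eq

variable {k}

theorem hom_shift_shift_eq_zero {X Y : D} (h : ∀ r : ℤ, ∀ f : X ⟶ Y⟦r⟧, f = 0) (p q : ℤ)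
    (f : X⟦p⟧ ⟶ Y⟦q⟧) : f = 0 := by
  let e : Y⟦q⟧ ≅ Y⟦q - p⟧⟦p⟧ := (shiftFunctorAdd' D (q - p) p q (sub_add_cancel q p)).app Y
  obtain ⟨g, hg⟩ := (shiftFunctor D p).map_surjective (f ≫ e.hom)
  rwa [h _ g, Functor.map_zero, eq_comm, Preadditive.IsIso.comp_right_eq_zero] at hg

theorem IsExceptional.hom_shift_shift_eq_zero {X : D} (h : IsExceptional k X) {p q : ℤ}
    (hpq : p ≠ q) (f : X⟦p⟧ ⟶ X⟦q⟧) : f = 0 := by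
  obtain ⟨g, rfl⟩ := (homShiftEquiv k X X (sub_add_cancel q p)).surjective f
  rw [h.hom_eq_zero _ (sub_ne_zero.2 hpq.symm) g, map_zero]

theorem IsExceptional.end_shift_eq {X : D} (h : IsExceptional k X) {p : ℤ}
    (f : X⟦p⟧ ⟶ X⟦p⟧) : ∃ c : k, f = c • 𝟙 _ := by
  obtain ⟨g, rfl⟩ := (shiftFunctor D p).map_surjective f
  obtain ⟨c, hc, -⟩ := h.end_eq g
  exact ⟨c, by rw [hc, Functor.map_smul, CategoryTheory.Functor.map_id]⟩

theorem InDistTriang.comp_eq_zero {a m r : D} {f : a ⟶ m} {g : m ⟶ r} (h : InDistTriang f g) :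
    f ≫ g = 0 := by
  obtain ⟨h, hT⟩ := h
  exact comp_distTriang_mor_zero₁₂ _ hT

theorem InDistTriang.exact_left {a m r : D} {f : a ⟶ m} {g : m ⟶ r} (h : InDistTriang f g)
    {x : D} (φ : x ⟶ m) (hφ : φ ≫ g = 0) : ∃ ψ, φ = ψ ≫ f := by
  obtain ⟨h, hT⟩ := h
  exact Triangle.coyoneda_exact₂ _ hT φ hφ

theorem InDistTriang.exact_right {a m r : D} {f : a ⟶ m} {g : m ⟶ r} (h : InDistTriang f g)
    {x : D} (φ : m ⟶ x) (hφ : f ≫ φ = 0) : ∃ ψ, φ = g ≫ ψ := by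
  obtain ⟨h, hT⟩ := h
  exact Triangle.yoneda_exact₂ _ hT φ hφ

/-- The obstruction is the composite with `r ⟶ a[1]`. It is killed by `f[1]`, so after one
desuspension the injectivity assumption makes it vanish. -/
theorem InDistTriang.exists_lift {a m r : D} {f : a ⟶ m} {g : m ⟶ r} (h : InDistTriang f g)
    {X : D} (hX : ∀ (p : ℤ) (ψ : X⟦p⟧ ⟶ a), ψ ≫ f = 0 → ψ = 0) (p : ℤ) (φ : X⟦p⟧ ⟶ r) :
    ∃ ψ, φ = ψ ≫ g := by
  obtain ⟨h, hT⟩ := h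
  refine Triangle.coyoneda_exact₃ _ hT φ ?_
  change φ ≫ h = 0
  let e : X⟦p⟧ ≅ X⟦p - 1⟧⟦(1 : ℤ)⟧ := (shiftFunctorAdd' D (p - 1) 1 p (sub_add_cancel p 1)).app X
  obtain ⟨ψ, hψ⟩ := (shiftFunctor D (1 : ℤ)).map_surjective (e.inv ≫ φ ≫ h)
  have h0 : h ≫ f⟦(1 : ℤ)⟧' = 0 := comp_distTriang_mor_zero₃₁ _ hT
  have : ψ = 0 := hX _ ψ ((shiftFunctor D (1 : ℤ)).map_injective (by
    rw [Functor.map_comp, hψ, Category.assoc, Category.assoc, h0, comp_zero, comp_zero,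
      Functor.map_zero]))
  rwa [this, Functor.map_zero, eq_comm, Preadditive.IsIso.comp_left_eq_zero] at hψ

theorem InDistTriang.exists_extension {a m r : D} {f : a ⟶ m} {g : m ⟶ r} (h : InDistTriang f g)
    {X : D} (hX : ∀ (p : ℤ) (ψ : r ⟶ X⟦p⟧), g ≫ ψ = 0 → ψ = 0) (p : ℤ) (φ : a ⟶ X⟦p⟧) :
    ∃ ψ, φ = f ≫ ψ := by
  obtain ⟨h, hT⟩ := h
  let e : X⟦p⟧⟦(1 : ℤ)⟧ ≅ X⟦p + 1⟧ := (shiftFunctorAdd D p 1).symm.app X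
  have h0 : g ≫ h = 0 := comp_distTriang_mor_zero₂₃ _ hT
  have h1 : h ≫ φ⟦(1 : ℤ)⟧' = 0 := by
    have := hX _ (h ≫ φ⟦(1 : ℤ)⟧' ≫ e.hom) (by rw [← Category.assoc, h0, zero_comp])
    rwa [← Category.assoc, Preadditive.IsIso.comp_right_eq_zero] at this
  obtain ⟨ψ, hψ⟩ : ∃ ψ : m⟦(1 : ℤ)⟧ ⟶ X⟦p⟧⟦(1 : ℤ)⟧, φ⟦(1 : ℤ)⟧' = (-f⟦(1 : ℤ)⟧') ≫ ψ :=
    Triangle.yoneda_exact₂ _ (rot_of_distTriang _ (rot_of_distTriang _ hT)) (φ⟦(1 : ℤ)⟧') h1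
  obtain ⟨ψ, rfl⟩ := (shiftFunctor D (1 : ℤ)).map_surjective ψ
  refine ⟨-ψ, (shiftFunctor D (1 : ℤ)).map_injective (hψ.trans ?_)⟩
  simp

theorem IsExceptionalCollection.isExceptionalFamily {n : ℕ} {E : Fin n → D}
    (hE : IsExceptionalCollection k E) :
    IsExceptionalFamily k (C := D) (P := ℤ) InDistTriang fun i p => (E i)⟦p⟧ where
  cone f := by
    obtain ⟨r, g, h, hT⟩ := distinguished_cocone_triangle f
    exact ⟨r, g, h, hT⟩
  comp_eq_zero h := h.comp_eq_zero
  exact_left h := h.exact_left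
  exact_right h := h.exact_right
  exists_lift h _ := h.exists_lift
  end_eq i _ := (hE.exceptional i).end_shift_eq
  eq_zero_of_ne i _ _ := (hE.exceptional i).hom_shift_shift_eq_zero
  eq_zero_of_lt i j hij := hom_shift_shift_eq_zero (hE.hom_eq_zero i j hij)
  finite_hom := finite_hom k
  finite_from _ _ := inferInstance
  finite_to _ _ := inferInstance

/-- Reversing arrows reverses the order of the collection, hence `Fin.rev`. The abstract family lets
the same argument run on both sides without a triangulation of `Dᵒᵖ`. -/
theorem IsExceptionalCollection.isExceptionalFamily_op {n : ℕ} {E : Fin n → D}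
    (hE : IsExceptionalCollection k E) :
    IsExceptionalFamily k (C := Dᵒᵖ) (P := ℤ) OpInDistTriang
      fun i p => Opposite.op ((E i.rev)⟦p⟧) where
  cone f := by
    obtain ⟨r, g, h, hT⟩ := distinguished_cocone_triangle₁ f.unop
    exact ⟨Opposite.op r, g.op, h, hT⟩
  comp_eq_zero h := Quiver.Hom.unop_inj (InDistTriang.comp_eq_zero h)
  exact_left h _ φ hφ := by
    obtain ⟨ψ, hψ⟩ := InDistTriang.exact_right h φ.unop (congrArg Quiver.Hom.unop hφ)
    exact ⟨ψ.op, Quiver.Hom.unop_inj hψ⟩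
  exact_right h _ φ hφ := by
    obtain ⟨ψ, hψ⟩ := InDistTriang.exact_left h φ.unop (congrArg Quiver.Hom.unop hφ)
    exact ⟨ψ.op, Quiver.Hom.unop_inj hψ⟩
  exists_lift h i hi p φ := by
    obtain ⟨ψ, hψ⟩ := InDistTriang.exists_extension h (X := E i.rev)
      (fun p ψ hψ => congrArg Quiver.Hom.unop (hi p ψ.op (Quiver.Hom.unop_inj hψ))) p φ.unop
    exact ⟨ψ.op, Quiver.Hom.unop_inj hψ⟩
  end_eq i _ f := by
    obtain ⟨c, hc⟩ := (hE.exceptional i.rev).end_shift_eq f.unop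
    exact ⟨c, Quiver.Hom.unop_inj hc⟩
  eq_zero_of_ne i _ _ hpq f :=
    Quiver.Hom.unop_inj ((hE.exceptional i.rev).hom_shift_shift_eq_zero hpq.symm f.unop)
  eq_zero_of_lt i j hij p q f := Quiver.Hom.unop_inj
    (hom_shift_shift_eq_zero (hE.hom_eq_zero j.rev i.rev (Fin.rev_lt_rev.2 hij)) q p f.unop)
  finite_hom x y := by
    have := finite_hom k y.unop x.unop
    exact Module.Finite.equiv (opLinearEquiv k y.unop x.unop).symm
  finite_from i x := by
    refine Finite.of_equiv (HomIndex k x.unop (E i.rev))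
      (Equiv.sigmaCongrRight fun p => finCongr ?_)
    exact (opLinearEquiv k x.unop ((E i.rev)⟦p⟧)).symm.finrank_eq
  finite_to i x := by
    refine Finite.of_equiv (Σ p : ℤ, Fin (Module.finrank k ((E i.rev)⟦p⟧ ⟶ x.unop)))
      (Equiv.sigmaCongrRight fun p => finCongr ?_)
    exact (opLinearEquiv k ((E i.rev)⟦p⟧) x.unop).symm.finrank_eq

/-- The pairing `Hom(X, Y) × Hom(Y, R) → k` defined by a form on `Hom(X, R)`. -/
def dualPairing {X R : D} (z : Module.Dual k (X ⟶ R)) (Y : D) :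
    (Y ⟶ R) →ₗ[k] Module.Dual k (X ⟶ Y) := (ContraModule.dual k X).eval z Y

@[simp]
theorem dualPairing_apply {X R : D} (z : Module.Dual k (X ⟶ R)) (Y : D) (f : Y ⟶ R) (h : X ⟶ Y) :
    dualPairing z Y f h = z (h ≫ f) := rfl

theorem exact_hom {a m r : D} {f : a ⟶ m} {g : m ⟶ r} (h : InDistTriang f g) (x : D) :
    Function.Exact (Linear.leftComp k x g) (Linear.leftComp k x f) := fun φ =>
  ⟨fun hφ => by
    obtain ⟨ψ, hψ⟩ := h.exact_right φ hφ
    exact ⟨ψ, hψ.symm⟩, by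
    rintro ⟨ψ, rfl⟩
    change f ≫ g ≫ ψ = 0
    rw [← Category.assoc, h.comp_eq_zero, zero_comp]⟩

theorem exact_dual_hom {a m r : D} {f : a ⟶ m} {g : m ⟶ r} (h : InDistTriang f g) (x : D) :
    Function.Exact (Linear.rightComp k x g).dualMap (Linear.rightComp k x f).dualMap := by
  rw [LinearMap.exact_iff, LinearMap.range_dualMap_eq_dualAnnihilator_ker,
    LinearMap.ker_dualMap_eq_dualAnnihilator_range]
  congr 1
  ext φ
  refine ⟨?_, fun hφ => ?_⟩
  · rintro ⟨ψ, rfl⟩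
    change (ψ ≫ f) ≫ g = 0
    rw [Category.assoc, h.comp_eq_zero, comp_zero]
  · obtain ⟨ψ, hψ⟩ := h.exact_left φ hφ
    exact ⟨ψ, hψ.symm⟩

theorem inDistTriang₁₂ {T : Triangle D} (hT : T ∈ distTriang D) : InDistTriang T.mor₁ T.mor₂ :=
  ⟨T.mor₃, hT⟩

theorem bijective_dualPairing_of_iso {X R : D} (z : Module.Dual k (X ⟶ R)) {Y Y' : D} (e : Y ≅ Y')
    (h : Function.Bijective (dualPairing z Y)) : Function.Bijective (dualPairing z Y') := by
  refine ⟨?_, fun f => ?_⟩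
  · rw [injective_iff_map_eq_zero]
    intro φ hφ
    have : dualPairing z Y (e.hom ≫ φ) = 0 := by
      ext h
      simpa using LinearMap.congr_fun hφ (h ≫ e.hom)
    exact (Preadditive.IsIso.comp_left_eq_zero _ _).1 ((injective_iff_map_eq_zero _).1 h.1 _ this)
  · obtain ⟨φ, hφ⟩ := h.2 ((Linear.rightComp k X e.hom).dualMap f)
    refine ⟨e.inv ≫ φ, ?_⟩
    ext h
    simpa using LinearMap.congr_fun hφ (h ≫ e.inv)

/-- Five lemma for `Hom(-, R) → Hom(X, -)^*` along `T₃[-1] → T₁ → T₂ → T₃ → T₁[1]`. -/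
theorem bijective_dualPairing_obj₂ {X R : D} (z : Module.Dual k (X ⟶ R)) {T : Triangle D}
    (hT : T ∈ distTriang D) (h₀ : Function.Bijective (dualPairing z (T.obj₃⟦(-1 : ℤ)⟧)))
    (h₁ : Function.Bijective (dualPairing z T.obj₁))
    (h₃ : Function.Bijective (dualPairing z T.obj₃))
    (h₄ : Function.Bijective (dualPairing z (T.obj₁⟦(1 : ℤ)⟧))) :
    Function.Bijective (dualPairing z T.obj₂) := by
  have t₃ : InDistTriang T.mor₂ T.mor₃ := inDistTriang₁₂ (rot_of_distTriang _ hT)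
  have t₂ := inDistTriang₁₂ hT
  have t₁ : InDistTriang T.invRotate.mor₁ T.mor₁ := inDistTriang₁₂ (inv_rot_of_distTriang _ hT)
  have hc : ∀ {a b : D} (f : a ⟶ b), (Linear.rightComp k X f).dualMap ∘ₗ dualPairing z b =
      dualPairing z a ∘ₗ Linear.leftComp k R f := fun f => by
    ext φ h
    simp
  exact LinearMap.bijective_of_surjective_of_bijective_of_bijective_of_injective
    (Linear.leftComp k R T.mor₃) (Linear.leftComp k R T.mor₂) (Linear.leftComp k R T.mor₁)
    (Linear.leftComp k R T.invRotate.mor₁) _ _ _ _ (dualPairing z _) (dualPairing z _)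
    (dualPairing z _) (dualPairing z _) (dualPairing z _) (hc _) (hc _) (hc _) (hc _)
    (exact_hom t₃ R) (exact_hom t₂ R) (exact_hom t₁ R) (exact_dual_hom t₃ X) (exact_dual_hom t₂ X)
    (exact_dual_hom t₁ X) h₄.2 h₃ h₁ h₀.1

/-- A form which induces perfect pairings on the translates of a full exceptional collection
induces perfect pairings on all objects. -/
theorem IsFullExceptionalCollection.bijective_dualPairing {n : ℕ} {E : Fin n → D}
    (hE : IsFullExceptionalCollection k E) {X R : D} (z : Module.Dual k (X ⟶ R))
    (hz : ∀ i (p : ℤ), Function.Bijective (dualPairing z ((E i)⟦p⟧))) (Y : D) :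
    Function.Bijective (dualPairing z Y) := by
  -- All translates are required at once: this makes `P` stable under shifts and supplies the outer
  -- terms of the five lemma.
  let P : ObjectProperty D := fun Y => ∀ p : ℤ, Function.Bijective (dualPairing z (Y⟦p⟧))
  have hiso : P.IsClosedUnderIsomorphisms := ⟨fun e hY p =>
    bijective_dualPairing_of_iso z ((shiftFunctor D p).mapIso e) (hY p)⟩
  have htri : P.IsTriangulated :=
    { exists_zero := by
        refine ⟨_, isZero_zero D, fun p => ⟨fun f g _ => ?_, fun f => ⟨0, ?_⟩⟩⟩
        · exact ((shiftFunctor D p).map_isZero (isZero_zero D)).eq_of_src f g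
        · ext h
          rw [((shiftFunctor D p).map_isZero (isZero_zero D)).eq_of_tgt h 0]
          simp
      isStableUnderShiftBy := fun a => ⟨fun Y hY p =>
        bijective_dualPairing_of_iso z ((shiftFunctorAdd D a p).app Y) (hY _)⟩
      ext₂' := fun T hT h1 h3 => ObjectProperty.le_isoClosure _ _ fun p =>
        bijective_dualPairing_obj₂ z (Triangle.shift_distinguished T hT p)
          (bijective_dualPairing_of_iso z ((shiftFunctorAdd D p (-1)).app T.obj₃) (h3 _))
          (h1 p) (h3 p) (bijective_dualPairing_of_iso z ((shiftFunctorAdd D p 1).app T.obj₁)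
            (h1 _)) }
  exact bijective_dualPairing_of_iso z ((shiftFunctorZero D ℤ).app Y)
    (hE.full P htri hiso hz Y 0)

/-- A pairing of finite-dimensional spaces is perfect on one side exactly when it is on the other.
-/
theorem bijective_flip_dualPairing {X R : D} (z : Module.Dual k (X ⟶ R)) (Y : D) :
    Function.Bijective (dualPairing z Y).flip ↔ Function.Bijective (dualPairing z Y) := by
  have := finite_hom k X Y
  exact LinearMap.flip_bijective_iff₂

theorem IsFullExceptionalCollection.exists_right_dual {n : ℕ} {E : Fin n → D}
    (hE : IsFullExceptionalCollection k E) (X : D) : ∃ (R : D) (z : Module.Dual k (X ⟶ R)),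
      ∀ Y, Function.Bijective (dualPairing z Y) := by
  obtain ⟨R, z, hz⟩ := hE.isExceptionalFamily.exists_dual_represents X
  exact ⟨R, z, hE.bijective_dualPairing z hz⟩

theorem IsFullExceptionalCollection.exists_left_dual {n : ℕ} {E : Fin n → D}
    (hE : IsFullExceptionalCollection k E) (R : D) : ∃ (X : D) (z : Module.Dual k (X ⟶ R)),
      ∀ Y, Function.Bijective (dualPairing z Y) := by
  have : HasFiniteBiproducts Dᵒᵖ := HasFiniteBiproducts.of_hasFiniteProducts
  obtain ⟨X, z, hz⟩ := hE.isExceptionalFamily_op.exists_dual_represents (Opposite.op R)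
  let z' : Module.Dual k (X.unop ⟶ R) := (opLinearEquiv k X.unop R).symm.dualMap z
  refine ⟨X.unop, z', hE.bijective_dualPairing z' fun i p => ?_⟩
  rw [← bijective_flip_dualPairing]
  have h := hz i.rev p
  rw [Fin.rev_rev] at h
  exact ((opLinearEquiv k ((E i)⟦p⟧) R).symm.dualMap.bijective.comp h).comp
    (opLinearEquiv k X.unop ((E i)⟦p⟧)).symm.bijective

end SerreDuality

/-! ### The Serre functor -/

section SerreFunctor

variable {k : Type w} [Field k] {D : Type u} [Category.{v} D] [Preadditive D] [HasZeroObject D]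
  [HasShift D ℤ] [∀ n : ℤ, (shiftFunctor D n).Additive] [Pretriangulated D] [Linear k D]
  [IsOfFiniteType k D] [∀ n : ℤ, (shiftFunctor D n).Linear k]

/-- The map on dual objects induced by a morphism `f`; it is characterized by
`z (h ≫ dualMap f) = z' (f ≫ h)`. -/
def serreMap {X X' R R' : D} {z : Module.Dual k (X ⟶ R)} (z' : Module.Dual k (X' ⟶ R'))
    (hz : ∀ Y, Function.Bijective (dualPairing z Y)) (f : X' ⟶ X) : R' ⟶ R :=
  (LinearEquiv.ofBijective _ (hz R')).symm (z'.comp (Linear.leftComp k R' f))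

theorem serreMap_spec {X X' R R' : D} {z : Module.Dual k (X ⟶ R)} (z' : Module.Dual k (X' ⟶ R'))
    (hz : ∀ Y, Function.Bijective (dualPairing z Y)) (f : X' ⟶ X) (h : X ⟶ R') :
    z (h ≫ serreMap z' hz f) = z' (f ≫ h) :=
  LinearMap.congr_fun ((LinearEquiv.ofBijective _ (hz R')).apply_symm_apply
    (z'.comp (Linear.leftComp k R' f))) h

theorem hom_ext_of_dualPairing {X R Y : D} {z : Module.Dual k (X ⟶ R)}
    (hz : ∀ Y, Function.Bijective (dualPairing z Y)) {f g : Y ⟶ R}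
    (h : ∀ t : X ⟶ Y, z (t ≫ f) = z (t ≫ g)) : f = g :=
  (hz Y).1 (LinearMap.ext h)

theorem hom_ext_of_dualPairing_left {X R Y : D} {z : Module.Dual k (X ⟶ R)}
    (hz : ∀ Y, Function.Bijective (dualPairing z Y)) {f g : X ⟶ Y}
    (h : ∀ t : Y ⟶ R, z (f ≫ t) = z (g ≫ t)) : f = g :=
  ((bijective_flip_dualPairing z Y).2 (hz Y)).1 (LinearMap.ext h)

theorem serreMap_add {X X' R R' : D} {z : Module.Dual k (X ⟶ R)} (z' : Module.Dual k (X' ⟶ R'))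
    (hz : ∀ Y, Function.Bijective (dualPairing z Y)) (f g : X' ⟶ X) :
    serreMap z' hz (f + g) = serreMap z' hz f + serreMap z' hz g :=
  hom_ext_of_dualPairing hz fun t => by
    rw [serreMap_spec, Preadditive.comp_add, Preadditive.add_comp, map_add, map_add,
      serreMap_spec, serreMap_spec]

theorem serreMap_smul {X X' R R' : D} {z : Module.Dual k (X ⟶ R)} (z' : Module.Dual k (X' ⟶ R'))
    (hz : ∀ Y, Function.Bijective (dualPairing z Y)) (c : k) (f : X' ⟶ X) :
    serreMap z' hz (c • f) = c • serreMap z' hz f :=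
  hom_ext_of_dualPairing hz fun t => by
    rw [serreMap_spec, Linear.comp_smul, Linear.smul_comp, map_smul, map_smul, serreMap_spec]

theorem serreMap_natural {X X' Y Y' R R' : D} {z : Module.Dual k (X ⟶ R)}
    (z' : Module.Dual k (X' ⟶ R')) (hz : ∀ Y, Function.Bijective (dualPairing z Y)) (f : X' ⟶ X)
    (g : Y ⟶ Y') (h : X ⟶ Y) (t : Y' ⟶ R') :
    z' ((f ≫ h ≫ g) ≫ t) = z (h ≫ g ≫ t ≫ serreMap z' hz f) := by
  rw [← Category.assoc g, ← Category.assoc h, serreMap_spec]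
  simp only [Category.assoc]

variable (R : D → D) (z : ∀ X, Module.Dual k (X ⟶ R X))
  (hz : ∀ X Y, Function.Bijective (dualPairing (z X) Y))

/-- A choice of dual objects is functorial. -/
def serreOfDual : D ⥤ D where
  obj := R
  map {X' X} f := serreMap (z X') (hz X) f
  map_id X := hom_ext_of_dualPairing (hz X) fun t => by
    rw [serreMap_spec, Category.id_comp, Category.comp_id]
  map_comp f g := hom_ext_of_dualPairing (hz _) fun t => by
    rw [serreMap_spec, ← Category.assoc t, serreMap_spec, ← Category.assoc, serreMap_spec]
    simp only [Category.assoc]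

theorem serreOfDual_map_spec {X X' : D} (f : X' ⟶ X) (h : X ⟶ R X') :
    z X (h ≫ (serreOfDual R z hz).map f) = z X' (f ≫ h) := serreMap_spec _ _ _ _

instance : (serreOfDual R z hz).Additive where
  map_add := serreMap_add _ _ _ _

instance : (serreOfDual R z hz).Linear k where
  map_smul f c := serreMap_smul _ _ c f

instance : (serreOfDual R z hz).Faithful where
  map_injective {X' X} f g hfg := hom_ext_of_dualPairing_left (hz X') fun t => by
    rw [← serreOfDual_map_spec R z hz, ← serreOfDual_map_spec R z hz, hfg]

instance : (serreOfDual R z hz).Full where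
  map_surjective {X' X} ψ := by
    obtain ⟨f, hf⟩ := ((bijective_flip_dualPairing (z X') X).2 (hz X' X)).2
      ((z X).comp (Linear.rightComp k X ψ))
    refine ⟨f, hom_ext_of_dualPairing (hz X) fun t => ?_⟩
    exact (serreOfDual_map_spec R z hz f t).trans (LinearMap.congr_fun hf t)

/-- Yoneda: both objects represent `Hom(X, -)^*`. -/
theorem nonempty_iso_of_dualPairing {X R R' : D} {z : Module.Dual k (X ⟶ R)}
    {z' : Module.Dual k (X ⟶ R')} (hz : ∀ Y, Function.Bijective (dualPairing z Y))
    (hz' : ∀ Y, Function.Bijective (dualPairing z' Y)) : Nonempty (R ≅ R') := by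
  obtain ⟨a, ha⟩ := (hz' R).2 z
  obtain ⟨b, hb⟩ := (hz R').2 z'
  replace ha : ∀ h, z' (h ≫ a) = z h := LinearMap.congr_fun ha
  replace hb : ∀ h, z (h ≫ b) = z' h := LinearMap.congr_fun hb
  refine ⟨a, b, hom_ext_of_dualPairing hz fun t => ?_, hom_ext_of_dualPairing hz' fun t => ?_⟩
  · rw [← Category.assoc, hb, ha, Category.comp_id]
  · rw [← Category.assoc, ha, hb, Category.comp_id]

theorem IsFullExceptionalCollection.nonempty_serreFunctor {n : ℕ} {E : Fin n → D}
    (hE : IsFullExceptionalCollection k E) : Nonempty (SerreFunctor k D) := by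
  choose R z hz using hE.exists_right_dual
  -- A left dual `X` of `Y` has both `Y` and `R X` as right duals.
  have hess : (serreOfDual R z hz).EssSurj := ⟨fun Y => by
    obtain ⟨X, z', hz'⟩ := hE.exists_left_dual Y
    exact ⟨X, nonempty_iso_of_dualPairing (hz X) hz'⟩⟩
  exact ⟨{
    functor := serreOfDual R z hz
    isEquivalence := {}
    additive := inferInstance
    linear := inferInstance
    pairing := fun X Y => LinearEquiv.ofBijective (dualPairing (z X) Y).flip
      ((bijective_flip_dualPairing (z X) Y).2 (hz X Y))
    natural := fun f g h t => serreMap_natural _ _ f g h t }⟩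

/-- `Hom(Y, (SX)[-p]) ≅ Hom(Y[p], SX)` is dual to `Hom(X, Y[p])`, and `p ↦ -p` preserves the sign.
-/
theorem eulerForm_serreFunctor (S : SerreFunctor k D) (X Y : D) :
    eulerForm k D (classK0 Y) (classK0 (S.functor.obj X)) =
      eulerForm k D (classK0 X) (classK0 Y) := by
  rw [isEulerForm_eulerForm, isEulerForm_eulerForm, ← finsum_comp_equiv (Equiv.neg ℤ)]
  refine finsum_congr fun p => ?_
  have h : Module.finrank k (Y ⟶ (S.functor.obj X)⟦-p⟧) = Module.finrank k (X ⟶ Y⟦p⟧) := by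
    rw [(S.pairing X (Y⟦p⟧)).finrank_eq, Subspace.dual_finrank_eq]
    exact ((homShiftEquiv k Y (S.functor.obj X) (neg_add_cancel p)).trans
      (homCongrRight k _ ((shiftFunctorZero D ℤ).app _))).finrank_eq
  rw [Equiv.neg_apply, Int.negOnePow_neg, h]

end SerreFunctor

/-! ### The root system and its invariance under mutation -/

section RootSystem

variable {k : Type w} [Field k] {D : Type u} [Category.{v} D] [Preadditive D] [HasZeroObject D]
  [HasShift D ℤ] [∀ n : ℤ, (shiftFunctor D n).Additive] [Pretriangulated D] [Linear k D]
  [IsOfFiniteType k D] [∀ n : ℤ, (shiftFunctor D n).Linear k]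

theorem eulerForm_eq_altSum (X Y : D) : eulerForm k D (classK0 X) (classK0 Y) =
    altSum fun p => Module.finrank k (X ⟶ Y⟦p⟧) := isEulerForm_eulerForm k X Y

theorem eulerForm_eq_zero {X Y : D} (h : ∀ (p : ℤ) (f : X ⟶ Y⟦p⟧), f = 0) :
    eulerForm k D (classK0 X) (classK0 Y) = 0 := by
  have : ∀ p : ℤ, Module.finrank k (X ⟶ Y⟦p⟧) = 0 := fun p => by
    have : Subsingleton (X ⟶ Y⟦p⟧) := subsingleton_of_forall_eq 0 (h p)
    exact Module.finrank_zero_of_subsingleton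
  simp [isEulerForm_eulerForm k X Y, this]

theorem IsExceptional.eulerForm_self {X : D} (h : IsExceptional k X) :
    eulerForm k D (classK0 X) (classK0 X) = 1 := by
  have hzero : ∀ p : ℤ, p ≠ 0 → Module.finrank k (X ⟶ X⟦p⟧) = 0 := fun p hp => by
    have : Subsingleton (X ⟶ X⟦p⟧) := subsingleton_of_forall_eq 0 (h.hom_eq_zero p hp)
    exact Module.finrank_zero_of_subsingleton
  have hone : Module.finrank k (X ⟶ X⟦(0 : ℤ)⟧) = 1 := by
    rw [(homCongrRight k X ((shiftFunctorZero D ℤ).app X)).finrank_eq]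
    refine finrank_eq_one (𝟙 X) (fun h0 => ?_) fun f => ?_
    · obtain ⟨c, -, hc⟩ := h.end_eq 0
      -- Uniqueness of the scalar is what rules out `𝟙 X = 0`.
      exact zero_ne_one ((hc 0 (by simp)).trans (hc 1 (by simp [h0])).symm)
    · obtain ⟨c, hc, -⟩ := h.end_eq f
      exact ⟨c, hc.symm⟩
  rw [isEulerForm_eulerForm, finsum_eq_single _ (0 : ℤ) fun p hp => by rw [hzero p hp]; simp, hone]
  simp

theorem IsExceptionalCollection.isUnitriangular {n : ℕ} {E : Fin n → D}
    (hE : IsExceptionalCollection k E) :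
    IsUnitriangular (eulerForm k D) fun i => classK0 (E i) where
  diag i := (hE.exceptional i).eulerForm_self
  lower i j hij := eulerForm_eq_zero (hE.hom_eq_zero i j hij)

theorem sum_negOnePow_homIndex (d : ℤ → ℕ) [Fintype (Σ p, Fin (d p))] :
    ∑ j : Σ p, Fin (d p), ((j.1.negOnePow : ℤˣ) : ℤ) = altSum d := by
  classical
  let s : Finset ℤ := Finset.univ.image (Sigma.fst : (Σ p, Fin (d p)) → ℤ)
  have hs : (Finset.univ : Finset (Σ p, Fin (d p))) = s.sigma fun _ => Finset.univ := by
    ext j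
    simp only [Finset.mem_univ, Finset.mem_sigma, and_true, true_iff]
    exact Finset.mem_image_of_mem _ (Finset.mem_univ j)
  rw [altSum, finsum_eq_sum_of_support_subset (s := s), hs, Finset.sum_sigma]
  · exact Finset.sum_congr rfl fun p _ => by simp [mul_comm]
  · intro p hp
    have : d p ≠ 0 := fun h => hp (by simp [h])
    exact Finset.mem_coe.2 (Finset.mem_image.2
      ⟨⟨p, 0, Nat.pos_of_ne_zero this⟩, Finset.mem_univ _, rfl⟩)

theorem classK0_coneObj {X Y : D} (f : X ⟶ Y) : classK0 (coneObj f) = classK0 Y - classK0 X := by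
  obtain ⟨g, h, hT⟩ := (distinguished_cocone_triangle f).choose_spec
  exact eq_sub_of_add_eq' (classK0_obj₂ hT).symm

/-- Each basis element of degree `p` contributes `[Y[p]] = (-1)^p [Y]`. For an exceptional pair
`χ(Y, X) = 0`, so the result is `-r_{[Y]} [X]`; the left mutation is analogous. -/
theorem classK0_rightMutation (X Y : D) : classK0 (rightMutation k Y X) =
    eulerForm k D (classK0 X) (classK0 Y) • classK0 Y - classK0 X := by
  let _ := Fintype.ofFinite (HomIndex k X Y)
  rw [rightMutation, classK0_coneObj, classK0_biproduct, eulerForm_eq_altSum,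
    ← sum_negOnePow_homIndex, Finset.sum_smul]
  simp only [classK0_shift]

theorem classK0_leftMutation (X Y : D) : classK0 (leftMutation k X Y) =
    eulerForm k D (classK0 X) (classK0 Y) • classK0 X - classK0 Y := by
  let _ := Fintype.ofFinite (HomIndex k X Y)
  rw [leftMutation, classK0_shift, classK0_coneObj, classK0_biproduct, eulerForm_eq_altSum,
    ← sum_negOnePow_homIndex, Finset.sum_smul]
  simp only [classK0_shift, Int.negOnePow_neg]
  simp

theorem cartanForm_comm (χ : LinearMap.BilinForm ℤ (TriangulatedK0 D)) (x y : TriangulatedK0 D) :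
    cartanForm χ x y = cartanForm χ y x := add_comm _ _

theorem cartanForm_apply (χ : LinearMap.BilinForm ℤ (TriangulatedK0 D)) (x y : TriangulatedK0 D) :
    cartanForm χ x y = χ x y + χ y x := rfl

theorem strandLo_lt_strandHi {n : ℕ} (i : Fin (n - 1)) : strandLo i < strandHi i :=
  Nat.lt_succ_self _

/-- Isomorphic collections, mutations and translations have the same real roots. -/
theorem MutationAction.realRoots_eq {n : ℕ} {g : MutationGroup n}
    {E F : FullExceptionalCollection k D n} (h : MutationAction k g E F) :
    realRoots (cartanForm (eulerForm k D)) F.1 = realRoots (cartanForm (eulerForm k D)) E.1 := by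
  have hnorm : ∀ (F : FullExceptionalCollection k D n) (i : Fin n),
      cartanForm (eulerForm k D) (classK0 (F.1 i)) (classK0 (F.1 i)) = 2 := fun F =>
    F.2.toIsExceptionalCollection.isUnitriangular.norm_eq_two
  have hlower : ∀ (F : FullExceptionalCollection k D n) (i : Fin (n - 1)),
      eulerForm k D (classK0 (F.1 (strandHi i))) (classK0 (F.1 (strandLo i))) = 0 := fun F i =>
    F.2.toIsExceptionalCollection.isUnitriangular.lower _ _ (strandLo_lt_strandHi i)
  induction h with
  | one h =>
    exact reflectionOrbit_range_eq_of_sign (cartanForm_comm _) (hnorm _) fun j =>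
      Or.inl (classK0_eq_of_iso (h j).some)
  | @braid g E F F' i _ h ih =>
    have hne := (strandLo_lt_strandHi i).ne
    have hcls := fun j => classK0_eq_of_iso (h j).some
    rw [← ih]
    refine reflectionOrbit_range_eq_of_mutation (cartanForm_comm _) (hnorm F)
      (s := strandLo i) (t := strandHi i) (s' := strandLo i) (t' := strandHi i) ?_ ?_ rfl ?_
    · rw [hcls]
      simp [braidMove]
    · rw [hcls]
      simp [braidMove, hne.symm, classK0_rightMutation, rootReflection_apply, cartanForm_apply,
        hlower F i]
    · intro j h1 h2
      rw [hcls]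
      simp [braidMove, h1, h2]
  | @braidInv g E F F' i _ h ih =>
    have hne := (strandLo_lt_strandHi i).ne
    have hcls := fun j => classK0_eq_of_iso (h j).some
    rw [← ih]
    -- The left mutation has the same shape with the two strands exchanged.
    refine reflectionOrbit_range_eq_of_mutation (cartanForm_comm _) (hnorm F)
      (s := strandHi i) (t := strandLo i) (s' := strandHi i) (t' := strandLo i) ?_ ?_ rfl ?_
    · rw [hcls]
      simp [braidInvMove, hne.symm]
    · rw [hcls]
      simp [braidInvMove, classK0_leftMutation, rootReflection_apply, cartanForm_apply,
        hlower F i]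
    · intro j h1 h2
      rw [hcls]
      simp [braidInvMove, h1, h2]
  | @shift g E F F' i _ h ih =>
    rw [← ih]
    refine reflectionOrbit_range_eq_of_sign (cartanForm_comm _) (hnorm F) fun j => ?_
    rw [classK0_eq_of_iso (h j).some]
    split_ifs
    · exact Or.inr (classK0_shift_one _)
    · exact Or.inl rfl
  | @shiftInv g E F F' i _ h ih =>
    rw [← ih]
    refine reflectionOrbit_range_eq_of_sign (cartanForm_comm _) (hnorm F) fun j => ?_
    rw [classK0_eq_of_iso (h j).some]
    split_ifs
    · exact Or.inr (by simp [classK0_shift])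
    · exact Or.inl rfl

/-- Both lengths equal the rank of K₀. Transitivity concerns a fixed length, so this is needed to
compare arbitrary full collections. -/
theorem IsFullExceptionalCollection.length_eq {m n : ℕ} {E : Fin m → D} {F : Fin n → D}
    (hE : IsFullExceptionalCollection k E) (hF : IsFullExceptionalCollection k F) : n = m := by
  have key : ∀ {l : ℕ} {G : Fin l → D}, IsFullExceptionalCollection k G →
      Module.finrank ℤ (TriangulatedK0 D) = l := fun {l G} hG => by
    rw [Module.finrank_eq_card_basis (Module.Basis.mk
      hG.toIsExceptionalCollection.isUnitriangular.linearIndependent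
      (span_classK0_eq_top k hG).ge), Fintype.card_fin]
  exact (key hF).symm.trans (key hE)

/-- Both sides pair with each `[E_i]` on the left to `-χ([X], [E_i])`, and such pairings determine
an element. -/
theorem IsFullExceptionalCollection.coxeter_classK0 {n : ℕ} {E : Fin n → D}
    (hE : IsFullExceptionalCollection k E) (S : SerreFunctor k D) (X : D) :
    hE.toIsExceptionalCollection.isUnitriangular.coxeter (classK0 X) =
      classK0 (S.coxeterFunctor.obj X) := by
  have h := hE.toIsExceptionalCollection.isUnitriangular
  rw [← sub_eq_zero]
  refine h.eq_zero_of_right (span_classK0_eq_top k hE) _ fun i => ?_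
  have hS : classK0 (S.coxeterFunctor.obj X) = -classK0 (S.functor.obj X) := by
    change classK0 ((S.functor.obj X)⟦(-1 : ℤ)⟧) = _
    simp [classK0_shift]
  rw [map_sub, h.form_coxeter, hS, map_neg, eulerForm_serreFunctor, sub_self]

end RootSystem

end

theorem proposition2 {k : Type w} [Field k] [IsAlgClosed k] [CharZero k]
    {D : Type u} [Category.{v} D] [Preadditive D] [HasZeroObject D] [HasShift D ℤ]
    [∀ n : ℤ, (shiftFunctor D n).Additive] [Pretriangulated D] [IsTriangulated D]
    [Linear k D] [∀ n : ℤ, (shiftFunctor D n).Linear k] [IsOfFiniteType k D]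
    (halg : IsAlgebraicTriangulated.{w, v, u, v', u'} k D)
    {μ : ℕ} (E : Fin μ → D)
    (hfull : IsFullExceptionalCollection k E) (hstrong : IsStrong E)
    (htrans : MutationTransitive k D μ)
    (hexc : ∀ E' : D, IsExceptional k E' →
      ∃ (n : ℕ) (F : Fin n → D), IsFullExceptionalCollection k F ∧ ∃ i, F i = E') :
    ∃ (χ : LinearMap.BilinForm ℤ (TriangulatedK0 D))
      (c : TriangulatedK0 D ≃ₗ[ℤ] TriangulatedK0 D),
      IsEulerForm k D χ ∧
      Nonempty (SerreFunctor k D) ∧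
      (∀ (S : SerreFunctor k D) (X : D), c (classK0 X) = classK0 (S.coxeterFunctor.obj X)) ∧
      IsSimplyLacedGRS (cartanForm χ) (realRoots (cartanForm χ) E) c ∧
      ∀ (n : ℕ) (F : Fin n → D), IsFullExceptionalCollection k F →
        realRoots (cartanForm χ) F = realRoots (cartanForm χ) E := by
  have h := hfull.toIsExceptionalCollection.isUnitriangular
  refine ⟨eulerForm k D, h.coxeter, isEulerForm_eulerForm k, hfull.nonempty_serreFunctor,
    hfull.coxeter_classK0, h.isSimplyLacedGRS (span_classK0_eq_top k hfull), fun n F hF => ?_⟩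
  obtain rfl := hfull.length_eq hF
  obtain ⟨g, hg⟩ := htrans ⟨E, hfull⟩ ⟨F, hF⟩
  exact hg.realRoots_eq
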